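/- **Notation.** Let $\mathbb D=\{z\in\mathbb C:|z|<1\}$ and write $\bar{\mathbb D}(a,r)=\{z\in\mathbb C:|z-a|\le r\}$. Let $\mathcal A_1$ be the set of analytic functions $f$ on $\mathbb D$ with $f(0)=0$, $f'(0)=1$. For $f\in\mathcal A_1$ the function $f(z)/z$ is given the value $1$ at $z=0$, and so is $zf'(z)/f(z)$. For a zero-free analytic function $h$ on $\mathbb D$ with $h(0)=1$, $\operatorname{Log}h$ is the analytic branch of $\log h$ with $\operatorname{Log}h(0)=0$, $\operatorname{Arg}h=\operatorname{Im}\operatorname{Log}h$, and $h^c=\exp(c\operatorname{Log}h)$ for $c\in\mathbb C$. Let $\mathcal{ZF}$ be the set of $f\in\mathcal A_1$ for which $f(z)/z$ is zero-free in $\mathbb D$. For $f\in\mathcal{ZF}$ and $c\in\mathbb C$ put $$K_c[f](z)=z\left(\frac{f(z)}z\right)^c .$$ For $\mathcal M,\mathcal N\subset\mathcal{ZF}$ put $[\mathcal M,\mathcal N]_K=\{c\in\mathbb C: K_c[f]\in\mathcal N\text{ for all }f\in\mathcal M\}$ and $V(\mathcal M)=\{zf'(z)/f(z): f\in\mathcal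 M,\ z\in\mathbb D\}$. Let $T(w)=1/(1-w)$, with $T(1)=\infty$. **Classes.** - $\mathcal S$: the univalent (injective) functions in $\mathcal A_1$. - $\mathcal K$: the functions $f\in\mathcal S$ with $f(\mathbb D)$ convex. - $\mathrm{spl}(\lambda)$, for $-\pi/2<\lambda<\pi/2$: the functions $f\in\mathcal S$ such that for every $a\in f(\mathbb D)\setminus\{0\}$ the spiral segment $\{0\}\cup\{a\exp(-te^{i\lambda}):t\ge0\}$ is contained in $f(\mathbb D)$. - $\mathrm{spl}=\bigcup_{-\pi/2<\lambda<\pi/2}\mathrm{spl}(\lambda)$ and $\mathcal S^*=\mathrm{spl}(0)$. - $\mathcal S^*(\alpha)$: the functions $f\in\mathcal{ZF}$ with $\operatorname{Re}(zf'(z)/f(z))\ge\alpha$ in $\mathbb D$. - $\mathcal{SS}(\alpha)$, for $0<\alpha<1$: the functions $f\in\mathcal{ZF}$ with $zf'(z)/f(z)$ zero-free and $|\operatorname{Arg}(zf'(z)/f(z))|<\pi\alpha/2$ in $\mathbb D$. - $\mathrm{spl}(\lambda,\alpha)$: the functions $f\in\mathcal{ZF}$ with $zf'(z)/f(z)$ zero-free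 and $|\operatorname{Arg}(zf'(z)/f(z))-\lambda|<\pi\alpha/2$ in $\mathbb D$. - $\mathcal{CC}$ (close-to-convex functions): the functions $f\in\mathcal A_1$ such that $\operatorname{Re}(e^{-i\lambda}f'/g')>0$ in $\mathbb D$ for some $g\in\mathcal K$ and some $\lambda\in(-\pi/2,\pi/2)$. **Theorem.** 1. $[\mathcal S^*,\mathcal S]_K=[\mathcal S^*,\mathrm{spl}]_K=\bar{\mathbb D}(\tfrac12,\tfrac12)$. 2. $[\mathcal S^*(\alpha),\mathcal S]_K=[\mathcal S^*(\alpha),\mathrm{spl}]_K=\bar{\mathbb D}\big(\tfrac1{2(1-\alpha)},\tfrac1{2(1-\alpha)}\big)$ for $0\le\alpha<1$. 3. $[\mathcal K,\mathcal S]_K=[\mathcal K,\mathrm{spl}]_K=\bar{\mathbb D}(1,1)$. 4. $[\mathrm{spl}(\lambda),\mathcal S]_K=[\mathrm{spl}(\lambda),\mathrm{spl}]_K=\bar{\mathbb D}\big(\tfrac{1-i\tan\lambda}2,\tfrac1{2\cos\lambda}\big)$ for $-\pi/2<\lambda<\pi/2$. 5. $[\mathrm{spl},\mathcal S]_K=[\mathrm{spl},\mathrm{spl}]_K=[0,1]$.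 6. For $0<\alpha<1$, $$[\mathcal{SS}(\alpha),\mathcal S]_K=[\mathcal{SS}(\alpha),\mathrm{spl}]_K=\bar{\mathbb D}\Big(\tfrac{1-i\cot(\pi\alpha/2)}2,\tfrac1{2\sin(\pi\alpha/2)}\Big)\cup\bar{\mathbb D}\Big(\tfrac{1+i\cot(\pi\alpha/2)}2,\tfrac1{2\sin(\pi\alpha/2)}\Big).$$ 7. For $|\lambda|<\pi\alpha/2<\pi/2$, with $\lambda_\pm=\lambda\pm\pi(1-\alpha)/2$, $$[\mathrm{spl}(\lambda,\alpha),\mathcal S]_K=[\mathrm{spl}(\lambda,\alpha),\mathrm{spl}]_K=\bar{\mathbb D}\Big(\tfrac{1-i\tan\lambda_+}2,\tfrac1{2\cos\lambda_+}\Big)\cup\bar{\mathbb D}\Big(\tfrac{1-i\tan\lambda_-}2,\tfrac1{2\cos\lambda_-}\Big).$$ 8. $[\mathcal S,\mathcal S]_K=[\mathcal{CC},\mathcal S]_K=\{0,1\}$. Moreover, for every class $\mathcal M$ occurring on the left in 1–8 (with the stated parameters), $[\mathcal M,\mathcal S]_K=\mathbb C\setminus T(V(\mathcal M))$. -/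

import Mathlib

namespace PowerDeformation

/-- The open unit disk `𝔻`. -/
def disk : Set ℂ := Metric.ball 0 1

/-- The class `𝒜₁` of analytic functions on the unit disk with `f 0 = 0`, `f' 0 = 1`.
A function on the disk is represented by a total function `ℂ → ℂ`; every notion below depends
only on its values on the disk. -/
def ClassA1 : Set (ℂ → ℂ) :=
  {f | AnalyticOnNhd ℂ f disk ∧ f 0 = 0 ∧ deriv f 0 = 1}

/-- The class `𝒜₀^×` of zero-free analytic functions on the unit disk with `h 0 = 1`. -/
def ClassA0x : Set (ℂ → ℂ) :=
  {h | AnalyticOnNhd ℂ h disk ∧ h 0 = 1 ∧ ∀ z ∈ disk, h z ≠ 0}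

theorem exists_log {h : ℂ → ℂ} (hh : h ∈ ClassA0x) :
    ∃ L : ℂ → ℂ, AnalyticOnNhd ℂ L disk ∧ L 0 = 0 ∧ ∀ z ∈ disk, Complex.exp (L z) = h z := by
  obtain ⟨ha, h0, hne⟩ := hh
  have hd : DifferentiableOn ℂ (fun z => deriv h z / h z) disk := fun z hz =>
    ((ha.deriv z hz).div (ha z hz) (hne z hz)).differentiableAt.differentiableWithinAt
  obtain ⟨L, hL0, hL⟩ := (DifferentiableOn.isExactOn_ball hd).with_val_at 0 0
  have hLd : DifferentiableOn ℂ L disk := fun z hz =>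
    (hL z hz).differentiableAt.differentiableWithinAt
  refine ⟨L, hLd.analyticOnNhd Metric.isOpen_ball, hL0, fun z hz => ?_⟩
  have hmem : (0 : ℂ) ∈ disk := by simp [disk]
  have hder : ∀ x ∈ disk, HasDerivAt (fun w => h w * Complex.exp (-L w)) 0 x := by
    intro x hx
    have h1 := (ha x hx).differentiableAt.hasDerivAt
    have h2 := h1.mul ((hL x hx).neg.cexp)
    have h3 : deriv h x * Complex.exp (-L x) +
        h x * (Complex.exp (-L x) * -(deriv h x / h x)) = 0 := by
      have := hne x hx
      field_simp
      ring
    exact h3 ▸ h2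
  have hconst := (convex_ball (0 : ℂ) 1).is_const_of_fderivWithin_eq_zero (𝕜 := ℂ)
    (f := fun w => h w * Complex.exp (-L w))
    (fun x hx => (hder x hx).differentiableAt.differentiableWithinAt)
    (fun x hx => by
      rw [fderivWithin_of_isOpen Metric.isOpen_ball hx]
      ext
      simp [(hder x hx).deriv]) hz hmem
  simp only [h0, hL0, neg_zero, Complex.exp_zero, mul_one] at hconst
  rw [Complex.exp_neg] at hconst
  have := Complex.exp_ne_zero (L z)
  field_simp at hconst
  exact hconst.symm

open Classical in
/-- `Log h` is the analytic branch of `log h` on the disk with `Log h 0 = 0`,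
for `h` in `𝒜₀^×` (and `0` for other `h`). It is unique on the disk. -/
noncomputable def Log (h : ℂ → ℂ) : ℂ → ℂ :=
  if hh : h ∈ ClassA0x then Classical.choose (exists_log hh) else 0

theorem log_spec {h : ℂ → ℂ} (hh : h ∈ ClassA0x) :
    AnalyticOnNhd ℂ (Log h) disk ∧ Log h 0 = 0 ∧ ∀ z ∈ disk, Complex.exp (Log h z) = h z := by
  rw [Log, dif_pos hh]
  exact Classical.choose_spec (exists_log hh)

/-- `Arg h = Im (Log h)`. -/
noncomputable def Arg (h : ℂ → ℂ) (z : ℂ) : ℝ := (Log h z).im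

/-- The function `f(z)/z`, with its removable singularity at `0` filled in by `f' 0`
(for `f 0 = 0`). -/
noncomputable def overZ (f : ℂ → ℂ) : ℂ → ℂ := dslope f 0

/-- The quantity `z f'(z) / f(z)`, with value `f' 0 / f' 0 = 1` at `z = 0` for `f` in `𝒜₁`. -/
noncomputable def logDer (f : ℂ → ℂ) (z : ℂ) : ℂ := deriv f z / overZ f z

/-- The class `𝒵ℱ` of functions in `𝒜₁` without zeros other than the origin. -/
def ClassZF : Set (ℂ → ℂ) := {f | f ∈ ClassA1 ∧ overZ f ∈ ClassA0x}

/-- The class `𝒮` of univalent functions in `𝒜₁`. -/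
def ClassS : Set (ℂ → ℂ) := {f | f ∈ ClassA1 ∧ Set.InjOn f disk}

/-- The class `𝒦` of convex functions: univalent with convex image. -/
def ClassConvex : Set (ℂ → ℂ) := {f | f ∈ ClassS ∧ Convex ℝ (f '' disk)}

/-- The `l`-spiral segment `[0,a]_l`. -/
noncomputable def spiralSegment (l : ℝ) (a : ℂ) : Set ℂ :=
  {0} ∪ {w | ∃ t : ℝ, 0 ≤ t ∧ w = a * Complex.exp (-(t : ℂ) * Complex.exp (l * Complex.I))}

/-- `l`-spirallikeness (about the origin). Applied below only to images of the disk under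
univalent functions, which are domains. -/
def IsSpirallike (l : ℝ) (Ω : Set ℂ) : Prop :=
  ∀ a ∈ Ω, a ≠ 0 → spiralSegment l a ⊆ Ω

/-- The class of `l`-spirallike functions. -/
def ClassSpl (l : ℝ) : Set (ℂ → ℂ) := {f | f ∈ ClassS ∧ IsSpirallike l (f '' disk)}

/-- The class of spirallike functions: the union over all `l` in `(-π/2, π/2)`. -/
def ClassSplAll : Set (ℂ → ℂ) :=
  {f | ∃ l : ℝ, -(Real.pi / 2) < l ∧ l < Real.pi / 2 ∧ f ∈ ClassSpl l}

/-- The class `𝒮*` of starlike functions. -/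
def ClassStarlike : Set (ℂ → ℂ) := ClassSpl 0

/-- The class `𝒮*(α)` of starlike functions of order `α`. -/
def ClassStarlikeOrder (α : ℝ) : Set (ℂ → ℂ) :=
  {f | f ∈ ClassZF ∧ ∀ z ∈ disk, α ≤ (logDer f z).re}

/-- The class of strongly `l`-spirallike functions of order `α`. -/
def ClassStronglySpl (l α : ℝ) : Set (ℂ → ℂ) :=
  {f | f ∈ ClassZF ∧ logDer f ∈ ClassA0x ∧
    ∀ z ∈ disk, |Arg (logDer f) z - l| < Real.pi * α / 2}

/-- The class of strongly starlike functions of order `α`. -/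
def ClassStronglyStarlike (α : ℝ) : Set (ℂ → ℂ) :=
  {f | f ∈ ClassZF ∧ logDer f ∈ ClassA0x ∧
    ∀ z ∈ disk, |Arg (logDer f) z| < Real.pi * α / 2}

/-- The class of close-to-convex functions. -/
def ClassCloseToConvex : Set (ℂ → ℂ) :=
  {f | f ∈ ClassA1 ∧ ∃ g ∈ ClassConvex, ∃ l : ℝ, -(Real.pi / 2) < l ∧ l < Real.pi / 2 ∧
    ∀ z ∈ disk, 0 < (Complex.exp (-(l * Complex.I)) * (deriv f z / deriv g z)).re}

/-- The power deformation `K_c[f](z) = z (f(z)/z)^c`, where `(f(z)/z)^c = exp (c Log (f(z)/z))`. -/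
noncomputable def powerDeformation (c : ℂ) (f : ℂ → ℂ) : ℂ → ℂ :=
  fun z => z * Complex.exp (c * Log (overZ f) z)

/-- The set `[M, N]_K` of exponents `c` for which `K_c` maps `M` into `N`. -/
def exponents (M N : Set (ℂ → ℂ)) : Set ℂ := {c | ∀ f ∈ M, powerDeformation c f ∈ N}

/-- The variability region `V(M)` of `z f'(z) / f(z)` over `f ∈ M` and `z` in the disk. -/
def variability (M : Set (ℂ → ℂ)) : Set ℂ := {w | ∃ f ∈ M, ∃ z ∈ disk, w = logDer f z}

open Classical in
/-- The Möbius transformation `T(w) = 1/(1-w)` with values in the Riemann sphere, `T(1) = ∞`. -/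
noncomputable def moebiusT (w : ℂ) : OnePoint ℂ :=
  if w = 1 then OnePoint.infty else ((1 / (1 - w) : ℂ) : OnePoint ℂ)

/-- The complement of `T(V(M))` in `ℂ`. -/
def complTV (M : Set (ℂ → ℂ)) : Set ℂ :=
  {c | (c : OnePoint ℂ) ∉ moebiusT '' variability M}

end PowerDeformation

open PowerDeformation

namespace PowerDeformation

open Filter Topology Set

/-! Raising `f(z)/z` to the power `c` multiplies its logarithm by `c`, so with `p = z f'/f` the same
quantity for `K_c[f]` is `1 - c + c p`. If `K_c[f]` is univalent this never vanishes, that is, `p`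
omits `1 - 1/c`. Hence `[M, S]_K` always lies in the complement of `T(V(M))`.

Conversely, let `V(M)` be open and convex. For `c ≠ 0` outside `T(V(M))` a real line separates `1 -
1/c` from `V(M)`, which yields one `u` with `Re (u (1 - c + c p)) > 0` for all `f` in `M`. This
half-plane condition characterises spirallikeness, so `K_c[f]` is spirallike and the exponent sets
for `S` and `spl` coincide with the complement (`exponents_eq_complTV`).

What remains is to find `V(M)`. It is a half-plane for starlike, spirallike and convex functions
(the last by Marx–Strohhäcker) and a sector, the intersection of two half-planes, for the strong
classes. Under `c ↦ 1 - 1/c` a half-plane containing `1` becomes the complement of a closed disk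
through `0`. For `spl` one intersects over all tilts. For `S` and the close-to-convex functions `V`
is the plane without `0`, as slit mappings show, so only the trivial exponents `0` and `1` survive.
-/

theorem zero_mem_disk : (0 : ℂ) ∈ disk := by simp [disk]

theorem isOpen_disk : IsOpen disk := Metric.isOpen_ball

theorem mem_disk {z : ℂ} : z ∈ disk ↔ ‖z‖ < 1 := by simp [disk]

theorem isPreconnected_disk : IsPreconnected disk := (convex_ball (0 : ℂ) 1).isPreconnected

theorem AnalyticOnNhd.of_hasDerivAt {L g : ℂ → ℂ} {U : Set ℂ} (hU : IsOpen U)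
    (h : ∀ z ∈ U, HasDerivAt L (g z) z) : AnalyticOnNhd ℂ L U :=
  DifferentiableOn.analyticOnNhd
    (fun z hz => (h z hz).differentiableAt.differentiableWithinAt) hU

/-! ### Local injectivity and the derivative -/

/-- An analytic function that is injective near a point has non-zero derivative there. -/
theorem deriv_ne_zero_of_injOn {f : ℂ → ℂ} {U : Set ℂ} {z₀ : ℂ} (hU : U ∈ 𝓝 z₀)
    (hf : AnalyticAt ℂ f z₀) (hinj : InjOn f U) : deriv f z₀ ≠ 0 := by
  have hF : AnalyticAt ℂ (fun z => f z - f z₀) z₀ := hf.sub analyticAt_const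
  have hnc : ¬ ∀ᶠ z in 𝓝 z₀, f z - f z₀ = 0 := by
    intro h
    have h2 : ∀ᶠ z in 𝓝 z₀, z = z₀ := by
      filter_upwards [h, hU] with z hz hzU
      exact hinj hzU (mem_of_mem_nhds hU) (sub_eq_zero.mp hz)
    have h3 : ∀ᶠ z in 𝓝[≠] z₀, False := by
      filter_upwards [h2.filter_mono nhdsWithin_le_nhds, self_mem_nhdsWithin] with z hz hz'
      exact hz' hz
    exact NeBot.ne inferInstance (eventually_false_iff_eq_bot.mp h3)
  obtain ⟨n, g, hg, hg0, hfg⟩ := hF.exists_eventuallyEq_pow_smul_nonzero_iff.mpr hnc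
  have hn0 : n ≠ 0 := by
    rintro rfl
    have := hfg.self_of_nhds
    simp at this
    exact hg0 this.symm
  -- A local `n`-th root of `f - f z₀`, up to the constant `g z₀`; dividing by `g z₀` puts the base
  -- of the power near `1`, away from the branch cut. Since `φ' = 1` at `z₀`, `φ` is a local
  -- coordinate.
  set φ : ℂ → ℂ := fun z => (z - z₀) * (g z / g z₀) ^ ((n : ℂ)⁻¹) with hφ
  have hone : g z₀ / g z₀ = 1 := div_self hg0
  have hroot : AnalyticAt ℂ (fun z => (g z / g z₀) ^ ((n : ℂ)⁻¹)) z₀ := by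
    refine AnalyticAt.cpow (hg.div analyticAt_const hg0) analyticAt_const ?_
    rw [hone]; exact Complex.one_mem_slitPlane
  have hφd : HasStrictDerivAt φ 1 z₀ := by
    have h1 : HasStrictDerivAt (fun z : ℂ => z - z₀) 1 z₀ :=
      (hasStrictDerivAt_id z₀).sub_const z₀
    convert! h1.mul hroot.hasStrictDerivAt using 1
    simp [hone]
  have hmap := hφd.map_nhds_eq one_ne_zero
  have hφ0 : φ z₀ = 0 := by simp [hφ]
  have hpow : ∀ᶠ z in 𝓝 z₀, f z - f z₀ = g z₀ * φ z ^ n := by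
    filter_upwards [hfg] with z hz
    rw [hz, hφ]
    simp only [smul_eq_mul, mul_pow]
    rw [Complex.cpow_nat_inv_pow _ hn0]
    field_simp
  by_cases hn1 : n = 1
  · subst hn1
    have hd : HasDerivAt (fun z => f z - f z₀) (g z₀) z₀ := by
      have h1 := (hφd.hasDerivAt.const_mul (g z₀))
      rw [mul_one] at h1
      refine h1.congr_of_eventuallyEq ?_
      filter_upwards [hpow] with z hz
      simpa using hz
    have h2 := hd.add_const (f z₀)
    simp only [sub_add_cancel] at h2
    rw [h2.deriv]; exact hg0
  · exfalso
    -- For `n ≥ 2` the points with `φ = ε/2` and `φ = ζ ε/2`, `ζ` a primitive `n`-th root of unity,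
    -- have the same image under `f`.
    have hV : U ∩ {z | f z - f z₀ = g z₀ * φ z ^ n} ∈ 𝓝 z₀ := inter_mem hU hpow
    have him := image_mem_map (m := φ) hV
    rw [hmap, hφ0, Metric.mem_nhds_iff] at him
    obtain ⟨ε, hε, hb⟩ := him
    have hζ := Complex.isPrimitiveRoot_exp n hn0
    set ζ := Complex.exp (2 * Real.pi * Complex.I / n)
    have hζn : ‖ζ‖ = 1 := hζ.norm'_eq_one hn0
    have hw : ((ε / 2 : ℝ) : ℂ) ∈ Metric.ball (0 : ℂ) ε := by
      simp [abs_of_pos hε]; linarith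
    have hw2 : ζ * ((ε / 2 : ℝ) : ℂ) ∈ Metric.ball (0 : ℂ) ε := by
      rw [mem_ball_zero_iff, norm_mul, hζn, one_mul]; simpa using hw
    obtain ⟨z1, ⟨hz1U, hz1⟩, e1⟩ := hb hw
    obtain ⟨z2, ⟨hz2U, hz2⟩, e2⟩ := hb hw2
    simp only [mem_ofPred_eq] at hz1 hz2
    rw [e1] at hz1
    rw [e2, mul_pow, hζ.pow_eq_one, one_mul, ← hz1] at hz2
    have h12 : z2 = z1 := hinj hz2U hz1U (by linear_combination hz2)
    rw [h12, e1] at e2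
    have hne : ((ε / 2 : ℝ) : ℂ) ≠ 0 := by
      exact_mod_cast (by positivity : (ε / 2 : ℝ) ≠ 0)
    have : ζ = 1 := by
      apply mul_right_cancel₀ hne
      rw [← e2, one_mul]
    exact hζ.ne_one (by omega) this

/-! ### Analytic logarithms of `f(z)/z` and the quantity `z f'/f` -/

theorem analyticOnNhd_overZ {f : ℂ → ℂ} (hf : AnalyticOnNhd ℂ f disk) :
    AnalyticOnNhd ℂ (overZ f) disk := by
  have := (Complex.differentiableOn_dslope (f := f)
    (isOpen_disk.mem_nhds zero_mem_disk)).mpr hf.differentiableOn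
  exact this.analyticOnNhd isOpen_disk

theorem overZ_zero (f : ℂ → ℂ) : overZ f 0 = deriv f 0 := dslope_same f 0

theorem mul_overZ {f : ℂ → ℂ} (hf : f 0 = 0) (z : ℂ) : z * overZ f z = f z := by
  have := sub_smul_dslope f 0 z
  simpa [hf, overZ] using this

theorem overZ_of_ne {f : ℂ → ℂ} (hf : f 0 = 0) {z : ℂ} (hz : z ≠ 0) : overZ f z = f z / z := by
  rw [← mul_overZ hf z]; field_simp

theorem logDer_of_ne {f : ℂ → ℂ} (hf : f 0 = 0) {z : ℂ} (hz : z ≠ 0) :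
    logDer f z = z * deriv f z / f z := by
  rw [logDer, overZ_of_ne hf hz, div_div_eq_mul_div, mul_comm]

theorem logDer_zero {f : ℂ → ℂ} (hf : f ∈ ClassA1) : logDer f 0 = 1 := by
  rw [logDer, overZ_zero, hf.2.2, div_one]

theorem analyticOnNhd_logDer {f : ℂ → ℂ} (hf : f ∈ ClassZF) :
    AnalyticOnNhd ℂ (logDer f) disk := fun z hz =>
  (hf.1.1.deriv z hz).div (hf.2.1 z hz) (hf.2.2.2 z hz)

theorem ClassZF.of_forall_ne {f : ℂ → ℂ} (hf : f ∈ ClassA1) (h : ∀ z ∈ disk, z ≠ 0 → f z ≠ 0) :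
    f ∈ ClassZF := by
  refine ⟨hf, analyticOnNhd_overZ hf.1, by rw [overZ_zero, hf.2.2], fun z hz => ?_⟩
  by_cases h0 : z = 0
  · rw [h0, overZ_zero, hf.2.2]; exact one_ne_zero
  · rw [overZ_of_ne hf.2.1 h0]; exact div_ne_zero (h z hz h0) h0

theorem ClassZF.ne_zero {f : ℂ → ℂ} (hf : f ∈ ClassZF) {z : ℂ} (hz : z ∈ disk) (h0 : z ≠ 0) :
    f z ≠ 0 := by
  rw [← mul_overZ hf.1.2.1]; exact mul_ne_zero h0 (hf.2.2.2 z hz)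

theorem ClassS_subset_ClassZF : ClassS ⊆ ClassZF := fun _ hf =>
  ClassZF.of_forall_ne hf.1 fun _ hz h0 h =>
    h0 (hf.2 hz zero_mem_disk (h.trans hf.1.2.1.symm))

theorem ClassS.deriv_ne_zero {f : ℂ → ℂ} (hf : f ∈ ClassS) {z : ℂ} (hz : z ∈ disk) :
    deriv f z ≠ 0 :=
  deriv_ne_zero_of_injOn (isOpen_disk.mem_nhds hz) (hf.1.1 z hz) hf.2

theorem ClassS.logDer_ne_zero {f : ℂ → ℂ} (hf : f ∈ ClassS) {z : ℂ} (hz : z ∈ disk) :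
    logDer f z ≠ 0 :=
  div_ne_zero (ClassS.deriv_ne_zero hf hz) ((ClassS_subset_ClassZF hf).2.2.2 z hz)

theorem hasDerivAt_of_exp_eq {L h : ℂ → ℂ} (hL : AnalyticOnNhd ℂ L disk)
    (he : ∀ z ∈ disk, Complex.exp (L z) = h z) {z : ℂ} (hz : z ∈ disk) :
    HasDerivAt L (deriv h z / h z) z := by
  have h1 := (hL z hz).differentiableAt.hasDerivAt
  have h2 : deriv h z = Complex.exp (L z) * deriv L z := by
    have h3 : (fun w => Complex.exp (L w)) =ᶠ[𝓝 z] h := by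
      filter_upwards [isOpen_disk.mem_nhds hz] with w hw using he w hw
    rw [← h3.deriv_eq]; exact h1.cexp.deriv
  rw [h2, ← he z hz, mul_div_cancel_left₀ _ (Complex.exp_ne_zero _)]
  exact h1

theorem hasDerivAt_Log {h : ℂ → ℂ} (hh : h ∈ ClassA0x) {z : ℂ} (hz : z ∈ disk) :
    HasDerivAt (Log h) (deriv h z / h z) z :=
  hasDerivAt_of_exp_eq (log_spec hh).1 (log_spec hh).2.2 hz

theorem eqOn_disk_of_hasDerivAt {L M g : ℂ → ℂ} (hL : ∀ z ∈ disk, HasDerivAt L (g z) z)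
    (hM : ∀ z ∈ disk, HasDerivAt M (g z) z) (h0 : L 0 = M 0) : EqOn L M disk := by
  refine (convex_ball (0 : ℂ) 1).eqOn_of_fderivWithin_eq (𝕜 := ℂ)
    (fun x hx => (hL x hx).differentiableAt.differentiableWithinAt)
    (fun x hx => (hM x hx).differentiableAt.differentiableWithinAt)
    Metric.isOpen_ball.uniqueDiffOn (fun x hx => ?_) zero_mem_disk h0
  rw [fderivWithin_of_isOpen Metric.isOpen_ball hx, fderivWithin_of_isOpen Metric.isOpen_ball hx]
  ext
  simp [(hL x hx).deriv, (hM x hx).deriv]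

/-- Uniqueness of the analytic logarithm. -/
theorem Log_eqOn {h L : ℂ → ℂ} (hh : h ∈ ClassA0x) (hL : AnalyticOnNhd ℂ L disk) (h0 : L 0 = 0)
    (he : ∀ z ∈ disk, Complex.exp (L z) = h z) : EqOn (Log h) L disk :=
  eqOn_disk_of_hasDerivAt (fun _ hz => hasDerivAt_Log hh hz)
    (fun _ hz => hasDerivAt_of_exp_eq hL he hz) ((log_spec hh).2.1.trans h0.symm)

/-- A function of the form `z exp (L z)` with `L` analytic and `L 0 = 0`. -/
theorem mul_exp_mem_ClassZF {f L : ℂ → ℂ} (hL : AnalyticOnNhd ℂ L disk) (h0 : L 0 = 0)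
    (hf : ∀ z ∈ disk, f z = z * Complex.exp (L z)) :
    f ∈ ClassZF ∧ ∀ z ∈ disk, logDer f z = 1 + z * deriv L z := by
  have hd : ∀ z ∈ disk, HasDerivAt f (Complex.exp (L z) * (1 + z * deriv L z)) z := by
    intro z hz
    have h1 := (hasDerivAt_id z).mul (hL z hz).differentiableAt.hasDerivAt.cexp
    have h2 : HasDerivAt (fun z => z * Complex.exp (L z))
        (Complex.exp (L z) * (1 + z * deriv L z)) z := by
      convert! h1 using 1
      simp only [id]; ring
    refine h2.congr_of_eventuallyEq ?_
    filter_upwards [isOpen_disk.mem_nhds hz] with w hw using hf w hw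
  have hf0 : f 0 = 0 := by rw [hf 0 zero_mem_disk, zero_mul]
  have hA : f ∈ ClassA1 := ⟨AnalyticOnNhd.of_hasDerivAt isOpen_disk hd, hf0, by
    rw [(hd 0 zero_mem_disk).deriv, h0]; simp⟩
  have hov : ∀ z ∈ disk, overZ f z = Complex.exp (L z) := by
    intro z hz
    by_cases hz0 : z = 0
    · rw [hz0, overZ_zero, hA.2.2, h0, Complex.exp_zero]
    · rw [overZ_of_ne hf0 hz0, hf z hz]; field_simp
  refine ⟨⟨hA, analyticOnNhd_overZ hA.1, by rw [overZ_zero, hA.2.2], fun z hz => ?_⟩,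
    fun z hz => ?_⟩
  · rw [hov z hz]; exact Complex.exp_ne_zero _
  · rw [logDer, hov z hz, (hd z hz).deriv, mul_div_cancel_left₀ _ (Complex.exp_ne_zero _)]

theorem ClassZF.eq_mul_exp {f : ℂ → ℂ} (hf : f ∈ ClassZF) {z : ℂ} (hz : z ∈ disk) :
    f z = z * Complex.exp (Log (overZ f) z) := by
  rw [(log_spec hf.2).2.2 z hz, mul_overZ hf.1.2.1]

theorem ClassZF.logDer_eq {f : ℂ → ℂ} (hf : f ∈ ClassZF) {z : ℂ} (hz : z ∈ disk) :
    logDer f z = 1 + z * deriv (Log (overZ f)) z :=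
  (mul_exp_mem_ClassZF (log_spec hf.2).1 (log_spec hf.2).2.1 fun _ h =>
    ClassZF.eq_mul_exp hf h).2 z hz

theorem powerDeformation_spec {f : ℂ → ℂ} (hf : f ∈ ClassZF) (c : ℂ) :
    powerDeformation c f ∈ ClassZF ∧
      ∀ z ∈ disk, logDer (powerDeformation c f) z = 1 - c + c * logDer f z := by
  obtain ⟨hL, hL0, -⟩ := log_spec hf.2
  have h := mul_exp_mem_ClassZF (f := powerDeformation c f)
    (L := fun z => c * Log (overZ f) z) (fun z hz => analyticAt_const.mul (hL z hz))
    (by simp [hL0]) (fun z _ => rfl)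
  refine ⟨h.1, fun z hz => ?_⟩
  rw [h.2 z hz, ClassZF.logDer_eq hf hz, deriv_const_mul _ (hL z hz).differentiableAt]
  ring

/-- Every analytic function on the disk with value `1` at `0` is a logarithmic derivative. -/
theorem exists_logDer_eq {p : ℂ → ℂ} (hp : AnalyticOnNhd ℂ p disk) (h0 : p 0 = 1) :
    ∃ f ∈ ClassZF, ∀ z ∈ disk, logDer f z = p z := by
  have hd : DifferentiableOn ℂ (dslope p 0) disk :=
    (Complex.differentiableOn_dslope (isOpen_disk.mem_nhds zero_mem_disk)).mpr
      hp.differentiableOn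
  -- `dslope p 0` is `(p(z) - 1)/z` with the singularity removed; its primitive `L` is the logarithm
  -- of `f(z)/z`.
  obtain ⟨L, hL0, hL⟩ := (DifferentiableOn.isExactOn_ball hd).with_val_at 0 0
  have h := mul_exp_mem_ClassZF (f := fun z => z * Complex.exp (L z)) (L := L)
    (AnalyticOnNhd.of_hasDerivAt isOpen_disk hL) hL0 fun _ _ => rfl
  refine ⟨_, h.1, fun z hz => ?_⟩
  have h3 := sub_smul_dslope p 0 z
  rw [h.2 z hz, (hL z hz).deriv]
  simp only [sub_zero, smul_eq_mul, h0] at h3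
  rw [h3]; ring

/-! ### The necessary condition for univalence -/

theorem mem_complTV {M : Set (ℂ → ℂ)} {c : ℂ} :
    c ∈ complTV M ↔ c = 0 ∨ 1 - 1 / c ∉ variability M := by
  simp only [complTV, mem_ofPred_eq, mem_image, not_exists, not_and]
  by_cases hc : c = 0
  · simp only [hc, true_or, iff_true]
    intro w _ h
    rw [moebiusT] at h
    split_ifs at h with hw
    · exact OnePoint.infty_ne_coe _ h
    · rw [OnePoint.coe_eq_coe] at h
      exact one_div_ne_zero (sub_ne_zero.mpr (Ne.symm hw)) h
  · simp only [hc, false_or]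
    constructor
    · intro h hw
      apply h _ hw
      rw [moebiusT, if_neg (by simp [hc])]
      congr 1
      field_simp
      simp
    · intro h w hw e
      rw [moebiusT] at e
      split_ifs at e with hw1
      · exact OnePoint.infty_ne_coe _ e
      · rw [OnePoint.coe_eq_coe] at e
        apply h
        rw [← e]
        simpa using hw

/-- If `z f'/f` takes the value `1 - 1/c` at some point, then `1 - c + c z f'/f` vanishes there, so
the derivative of `K_c[f]` does too. -/
theorem exponents_ClassS_subset_complTV {M : Set (ℂ → ℂ)} (hM : M ⊆ ClassZF) :
    exponents M ClassS ⊆ complTV M := by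
  intro c hc
  rw [mem_complTV]
  by_contra! h
  obtain ⟨h0, f, hf, z, hz, e⟩ := h
  apply ClassS.logDer_ne_zero (hc f hf) hz
  rw [(powerDeformation_spec (hM hf) c).2 z hz, ← e]
  field_simp
  ring

/-! ### Univalence from a half-plane condition -/

/-- The Noshiro–Warschawski univalence criterion. -/
theorem injOn_of_re_deriv_pos {F F' : ℂ → ℂ} {U : Set ℂ} {u : ℂ} (hU : Convex ℝ U)
    (hF : ∀ z ∈ U, HasDerivAt F (F' z) z) (hpos : ∀ z ∈ U, 0 < (u * F' z).re) : InjOn F U := by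
  intro a ha b hb hab
  by_contra hne
  have hba : b - a ≠ 0 := sub_ne_zero.mpr (Ne.symm hne)
  have hmem : ∀ t ∈ Icc (0 : ℝ) 1, a + t * (b - a) ∈ U := by
    intro t ht
    have := hU.add_smul_sub_mem ha hb ht
    simpa using this
  -- Along the segment, `Re (u F / (b - a))` has derivative `Re (u F') > 0`, yet equal values at
  -- both ends: Rolle's theorem gives the contradiction.
  have hd : ∀ t ∈ Icc (0 : ℝ) 1,
      HasDerivAt (fun s : ℝ => (u * F (a + s * (b - a)) / (b - a)).re)
        (u * F' (a + t * (b - a))).re t := by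
    intro t ht
    have h1 : HasDerivAt (fun s : ℂ => a + s * (b - a)) (b - a) t := by
      simpa using ((hasDerivAt_id (t : ℂ)).mul_const (b - a)).const_add a
    have h2 := (((hF _ (hmem t ht)).comp (t : ℂ) h1).const_mul u).div_const (b - a)
    rw [← mul_assoc, mul_div_cancel_right₀ _ hba] at h2
    exact h2.real_of_complex
  obtain ⟨t, ht, h0⟩ := exists_hasDerivAt_eq_zero zero_lt_one
    (fun t ht => (hd t ht).continuousAt.continuousWithinAt) (by simp [hab])
    (fun t ht => hd t (Ioo_subset_Icc_self ht))
  exact (hpos _ (hmem t (Ioo_subset_Icc_self ht))).ne' h0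

theorem exp_mem_disk {ζ : ℂ} (h : ζ.re < 0) : Complex.exp ζ ∈ disk := by
  rw [mem_disk, Complex.norm_exp]; exact Real.exp_lt_one_iff.mpr h

/-- Lift `f` through `exp`: on the left half-plane, which is convex, `F` satisfies `exp (F ζ) = f
(exp ζ)` and `F' = logDer f ∘ exp`, so the Noshiro–Warschawski criterion makes `F` injective. As `F`
commutes with translation by `2πi`, injectivity descends to `f`. -/
theorem ClassZF.mem_ClassS_of_re_pos {f : ℂ → ℂ} (hf : f ∈ ClassZF) {u : ℂ}
    (hu : ∀ z ∈ disk, 0 < (u * logDer f z).re) : f ∈ ClassS := by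
  set F : ℂ → ℂ := fun ζ => ζ + Log (overZ f) (Complex.exp ζ) with hFdef
  have hinj : InjOn F {ζ : ℂ | ζ.re < 0} := by
    refine injOn_of_re_deriv_pos (F' := fun ζ => logDer f (Complex.exp ζ)) (u := u)
      (convex_halfSpace_re_lt 0) (fun ζ hζ => ?_) fun ζ hζ => hu _ (exp_mem_disk hζ)
    have h1 := ((log_spec hf.2).1 _ (exp_mem_disk hζ)).differentiableAt.hasDerivAt
    have h2 := (hasDerivAt_id ζ).add (h1.comp ζ (Complex.hasDerivAt_exp ζ))
    rw [ClassZF.logDer_eq hf (exp_mem_disk hζ), mul_comm (Complex.exp ζ)]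
    exact h2
  have hlog : ∀ z ∈ disk, z ≠ 0 → (Complex.log z).re < 0 := by
    intro z hz h0
    rw [Complex.log_re]
    exact Real.log_neg (norm_pos_iff.mpr h0) (mem_disk.mp hz)
  have hexp : ∀ z ∈ disk, z ≠ 0 → Complex.exp (F (Complex.log z)) = f z := by
    intro z hz h0
    rw [hFdef]
    simp only [Complex.exp_add, Complex.exp_log h0]
    exact (ClassZF.eq_mul_exp hf hz).symm
  refine ⟨hf.1, fun z hz w hw h => ?_⟩
  by_cases hz0 : z = 0
  · by_contra hne
    have hw0 : w ≠ 0 := fun h' => hne (hz0.trans h'.symm)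
    apply ClassZF.ne_zero hf hw hw0
    rw [← h, hz0, hf.1.2.1]
  by_cases hw0 : w = 0
  · exfalso
    apply ClassZF.ne_zero hf hz hz0
    rw [h, hw0, hf.1.2.1]
  rw [← hexp z hz hz0, ← hexp w hw hw0] at h
  obtain ⟨n, hn⟩ := Complex.exp_eq_exp_iff_exists_int.mp h
  have hper : Complex.exp (Complex.log w + n * (2 * Real.pi * Complex.I)) = w := by
    rw [Complex.exp_periodic.int_mul n, Complex.exp_log hw0]
  have hFn : F (Complex.log w + n * (2 * Real.pi * Complex.I)) =
      F (Complex.log w) + n * (2 * Real.pi * Complex.I) := by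
    simp only [hFdef, hper, Complex.exp_log hw0]; ring
  rw [← hFn] at hn
  have := hinj (hlog z hz hz0) (by simpa using hlog w hw hw0) hn
  rw [← Complex.exp_log hz0, this, hper]

/-! ### Spirallikeness as a half-plane condition on `z f'/f` -/

theorem ClassS.exists_inverse {f : ℂ → ℂ} (hf : f ∈ ClassS) :
    ∃ g : ℂ → ℂ, ∀ z ∈ disk, g (f z) = z ∧ HasStrictDerivAt g (deriv f z)⁻¹ (f z) := by
  have hg : ∀ z ∈ disk, Function.invFunOn f disk (f z) = z :=
    fun z hz => hf.2.leftInvOn_invFunOn hz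
  refine ⟨Function.invFunOn f disk, fun z hz => ⟨hg z hz, ?_⟩⟩
  refine ((hf.1.1 z hz).hasStrictDerivAt).to_local_left_inverse
    (ClassS.deriv_ne_zero hf hz) ?_
  filter_upwards [isOpen_disk.mem_nhds hz] with w hw using hg w hw

theorem ClassS.image_mem_nhds {f : ℂ → ℂ} (hf : f ∈ ClassS) {z : ℂ} (hz : z ∈ disk) :
    f '' disk ∈ 𝓝 (f z) := by
  rw [← ((hf.1.1 z hz).hasStrictDerivAt).map_nhds_eq (ClassS.deriv_ne_zero hf hz)]
  exact image_mem_map (isOpen_disk.mem_nhds hz)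

theorem eventually_norm_lt_of_re_neg {γ : ℝ → ℂ} {v : ℂ} (h : HasDerivAt γ v 0)
    (hv : (starRingEnd ℂ (γ 0) * v).re < 0) : ∀ᶠ s in 𝓝[>] (0 : ℝ), ‖γ s‖ < ‖γ 0‖ := by
  have h1 := h.norm_sq
  have h2 := hasDerivAt_iff_tendsto_slope.mp h1
  have h3 : 2 * inner ℝ (γ 0) v < 0 := by
    have : inner ℝ (γ 0) v = (starRingEnd ℂ (γ 0) * v).re := by
      rw [Complex.inner, mul_comm]
    rw [this]; linarith
  have h4 := h2.mono_left (nhdsWithin_mono 0 (fun s (hs : 0 < s) => hs.ne'))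
  filter_upwards [h4.eventually_lt_const h3, self_mem_nhdsWithin] with s hs hs0
  have hs0 : (0 : ℝ) < s := hs0
  rw [slope_def_field, sub_zero, div_lt_iff₀ hs0, zero_mul, sub_neg] at hs
  exact lt_of_pow_lt_pow_left₀ 2 (norm_nonneg _) hs

theorem eventually_norm_gt_of_re_pos {γ : ℝ → ℂ} {v : ℂ} (h : HasDerivAt γ v 0)
    (hv : 0 < (starRingEnd ℂ (γ 0) * v).re) : ∀ᶠ s in 𝓝[>] (0 : ℝ), ‖γ 0‖ < ‖γ s‖ := by
  have h1 := h.norm_sq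
  have h2 := hasDerivAt_iff_tendsto_slope.mp h1
  have h3 : 0 < 2 * inner ℝ (γ 0) v := by
    have : inner ℝ (γ 0) v = (starRingEnd ℂ (γ 0) * v).re := by
      rw [Complex.inner, mul_comm]
    rw [this]; linarith
  have h4 := h2.mono_left (nhdsWithin_mono 0 (fun s (hs : 0 < s) => hs.ne'))
  filter_upwards [h4.eventually_const_lt h3, self_mem_nhdsWithin] with s hs hs0
  have hs0 : (0 : ℝ) < s := hs0
  rw [slope_def_field, sub_zero, lt_div_iff₀ hs0, zero_mul, sub_pos] at hs
  exact lt_of_pow_lt_pow_left₀ 2 (norm_nonneg _) hs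

theorem re_inv_pos {w : ℂ} (h : 0 < w.re) : 0 < (w⁻¹).re := by
  rw [Complex.inv_re]
  exact div_pos h (Complex.normSq_pos.mpr fun h0 => by simp [h0] at h)

theorem re_inv_nonneg {w : ℂ} (h : 0 ≤ w.re) : 0 ≤ (w⁻¹).re := by
  rw [Complex.inv_re]
  exact div_nonneg h (Complex.normSq_nonneg _)

/-- The infinitesimal Schwarz lemma for a one-parameter family of maps subordinate to a
univalent function. -/
theorem ClassS.re_le_zero_of_subordinate {f : ℂ → ℂ} (hf : f ∈ ClassS) {Γ : ℝ → ℂ → ℂ} {z v : ℂ}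
    (hz : z ∈ disk) (han : ∀ t ∈ Icc (0 : ℝ) 1, AnalyticOnNhd ℂ (Γ t) disk)
    (hzero : ∀ t ∈ Icc (0 : ℝ) 1, Γ t 0 = 0)
    (hmaps : ∀ t ∈ Icc (0 : ℝ) 1, MapsTo (Γ t) disk (f '' disk)) (h0 : Γ 0 z = f z)
    (hd : HasDerivAt (fun t => Γ t z) v 0) :
    (starRingEnd ℂ z * ((deriv f z)⁻¹ * v)).re ≤ 0 := by
  obtain ⟨g, hg⟩ := ClassS.exists_inverse hf
  -- `g ∘ Γ t` maps the disk into itself and fixes `0`, so by the Schwarz lemma `‖g (Γ t z)‖ ≤ ‖z‖`,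
  -- with equality at `t = 0`; a positive radial velocity would violate this for small `t > 0`.
  by_contra! hpos
  have hγ : HasDerivAt (fun t => g (Γ t z)) ((deriv f z)⁻¹ * v) 0 := by
    have h1 := (hg z hz).2.hasDerivAt
    rw [← h0] at h1
    exact h1.comp (0 : ℝ) hd
  have hγ0 : g (Γ 0 z) = z := by rw [h0, (hg z hz).1]
  have hev := eventually_norm_gt_of_re_pos hγ (by simpa only [hγ0] using hpos)
  rw [hγ0] at hev
  have hI : Ioo (0 : ℝ) 1 ∈ 𝓝[>] (0 : ℝ) := Ioo_mem_nhdsGT zero_lt_one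
  obtain ⟨t, ht, ht'⟩ := (hev.and hI).exists
  have htI : t ∈ Icc (0 : ℝ) 1 := Ioo_subset_Icc_self ht'
  have hle : ‖g (Γ t z)‖ ≤ ‖z‖ := by
    refine Complex.norm_le_norm_of_mapsTo_ball (f := fun w => g (Γ t w)) (R := 1) ?_ ?_ ?_
      (mem_disk.mp hz)
    · intro w hw
      obtain ⟨y, hy, e⟩ := hmaps t htI hw
      have h1 := (hg y hy).2.hasDerivAt
      rw [e] at h1
      exact (h1.differentiableAt.comp w
        (han t htI w hw).differentiableAt).differentiableWithinAt
    · intro w hw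
      obtain ⟨y, hy, e⟩ := hmaps t htI hw
      simp only [← e, (hg y hy).1]
      exact Metric.ball_subset_closedBall hy
    · have := (hg 0 zero_mem_disk).1
      rw [hf.1.2.1] at this
      simp only [hzero t htI, this]
  exact absurd hle (not_le.mpr ht)

/-- The strong minimum principle for the real part. -/
theorem re_pos_of_re_nonneg {q : ℂ → ℂ} (hq : AnalyticOnNhd ℂ q disk)
    (h : ∀ z ∈ disk, 0 ≤ (q z).re) (h0 : 0 < (q 0).re) {z : ℂ} (hz : z ∈ disk) :
    0 < (q z).re := by
  rcases hq.is_constant_or_isOpen isPreconnected_disk with ⟨w, hw⟩ | ho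
  · rw [hw z hz, ← hw 0 zero_mem_disk]; exact h0
  · have h1 : q '' disk ⊆ interior {w : ℂ | 0 ≤ w.re} := by
      refine (ho disk subset_rfl isOpen_disk).subset_interior_iff.mpr ?_
      rintro _ ⟨w, hw, rfl⟩
      exact h w hw
    rw [Complex.interior_setOfPred_le_re] at h1
    exact h1 (mem_image_of_mem q hz)

/-- Translates radial velocity in the disk into `logDer`: motion of `f z` with velocity `f z * a`
pulls back to motion of `z` whose radial part has the sign of `Re (a / logDer f z)`. -/
theorem re_conj_mul_div {f : ℂ → ℂ} (hf : f ∈ ClassZF) {z : ℂ} (hz : z ∈ disk) (h0 : z ≠ 0)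
    (a : ℂ) : starRingEnd ℂ z * ((deriv f z)⁻¹ * (f z * a)) =
      ((‖z‖ ^ 2 : ℝ) : ℂ) * ((logDer f z)⁻¹ * a) := by
  have hfz := ClassZF.ne_zero hf hz h0
  rw [logDer_of_ne hf.1.2.1 h0, inv_div, Complex.ofReal_pow, ← Complex.conj_mul']
  by_cases hd : deriv f z = 0
  · simp [hd]
  · field_simp

theorem exp_mul_I_inv (l : ℝ) :
    (Complex.exp (l * Complex.I))⁻¹ = Complex.exp (-(l * Complex.I)) := (Complex.exp_neg _).symm

/-- Pulled back by `f`, a spiral moves inwards: the modulus of the preimage decreases, so the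
preimage cannot reach the unit circle. A continuation argument in time makes this rigorous. -/
theorem ClassZF.mem_ClassSpl_of_re_pos {f : ℂ → ℂ} (hf : f ∈ ClassZF) {l : ℝ}
    (hu : ∀ z ∈ disk, 0 < (Complex.exp (-(l * Complex.I)) * logDer f z).re) : f ∈ ClassSpl l := by
  have hS := ClassZF.mem_ClassS_of_re_pos hf hu
  refine ⟨hS, ?_⟩
  obtain ⟨g, hg⟩ := ClassS.exists_inverse hS
  rintro _ ⟨z₀, hz₀, rfl⟩ hne w (hw | ⟨t, ht, rfl⟩)
  · rw [mem_singleton_iff.mp hw]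
    exact ⟨0, zero_mem_disk, hS.1.2.1⟩
  set e : ℂ := Complex.exp (l * Complex.I) with he
  have hsub : Metric.closedBall (0 : ℂ) ‖z₀‖ ⊆ disk :=
    Metric.closedBall_subset_ball (mem_disk.mp hz₀)
  set γ : ℝ → ℂ := fun s => f z₀ * Complex.exp (-(s : ℂ) * e) with hγ
  have hγd : ∀ s, HasDerivAt γ (γ s * -e) s := by
    intro s
    have h1 : HasDerivAt (fun s : ℝ => -(s : ℂ) * e) (-e) s := by
      simpa using (Complex.ofRealCLM.hasDerivAt (x := s)).neg.mul_const e
    have h2 := h1.cexp.const_mul (f z₀)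
    rw [← mul_assoc] at h2
    exact h2
  have hγc : Continuous γ := continuous_iff_continuousAt.mpr fun s => (hγd s).continuousAt
  -- The times at which the spiral lies in the image of the closed disk of radius `‖z₀‖`. This set
  -- is closed by compactness, and the inward velocity lets each of its points be followed by later
  -- ones, so it contains `[0, t]`.
  set S : Set ℝ := γ ⁻¹' (f '' Metric.closedBall 0 ‖z₀‖) with hSdef
  have hScl : IsClosed S := by
    refine IsClosed.preimage hγc (IsCompact.isClosed ?_)
    exact (isCompact_closedBall _ _).image_of_continuousOn (hS.1.1.continuousOn.mono hsub)
  have hIcc : Icc 0 t ⊆ S := by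
    refine (hScl.inter isClosed_Icc).Icc_subset_of_forall_exists_gt ?_ ?_
    · exact ⟨z₀, by simp, by simp [hγ]⟩
    · rintro x ⟨⟨z₁, hz₁, hx⟩, -⟩ y hy
      have hz₁d := hsub hz₁
      have hz₁0 : z₁ ≠ 0 := by
        rintro rfl
        rw [hS.1.2.1] at hx
        exact mul_ne_zero hne (Complex.exp_ne_zero _) hx.symm
      have hγ' : HasDerivAt (fun s => γ (x + s)) (f z₁ * -e) 0 := by
        have := (hγd (x + 0)).comp_const_add x 0
        simpa [hx] using this
      have hδ : HasDerivAt (fun s => g (γ (x + s))) ((deriv f z₁)⁻¹ * (f z₁ * -e)) 0 := by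
        have h1 := (hg z₁ hz₁d).2.hasDerivAt
        have hx0 : f z₁ = γ (x + 0) := by rw [hx, add_zero]
        rw [hx0] at h1
        rw [hx0] at hγ' ⊢
        exact h1.comp (0 : ℝ) hγ'
      have hδ0 : g (γ (x + 0)) = z₁ := by rw [add_zero, ← hx, (hg z₁ hz₁d).1]
      have hneg : (starRingEnd ℂ z₁ * ((deriv f z₁)⁻¹ * (f z₁ * -e))).re < 0 := by
        rw [re_conj_mul_div hf hz₁d hz₁0, Complex.re_ofReal_mul, mul_neg, Complex.neg_re]
        have h1 := re_inv_pos (hu z₁ hz₁d)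
        rw [← exp_mul_I_inv, mul_inv, inv_inv, mul_comm] at h1
        have h2 : 0 < ‖z₁‖ ^ 2 := by positivity
        nlinarith [mul_pos h1 h2]
      have hev := eventually_norm_lt_of_re_neg hδ (by simpa only [hδ0] using hneg)
      rw [hδ0] at hev
      have hev2 : ∀ᶠ s in 𝓝[>] (0 : ℝ), γ (x + s) ∈ f '' disk := by
        refine Eventually.filter_mono nhdsWithin_le_nhds ?_
        have hc := hγ'.continuousAt
        have : f '' disk ∈ 𝓝 (γ (x + 0)) := by
          rw [add_zero, ← hx]; exact ClassS.image_mem_nhds hS hz₁d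
        exact hc this
      have hI : Ioo (0 : ℝ) (y - x) ∈ 𝓝[>] (0 : ℝ) := Ioo_mem_nhdsGT (sub_pos.mpr hy)
      obtain ⟨s, ⟨hs1, z₂, hz₂, hs2⟩, hs3⟩ := ((hev.and hev2).and hI).exists
      refine ⟨x + s, ⟨z₂, ?_, hs2⟩, by linarith [hs3.1], by linarith [hs3.2]⟩
      rw [← hs2, (hg z₂ hz₂).1] at hs1
      rw [mem_closedBall_zero_iff] at hz₁ ⊢
      exact hs1.le.trans hz₁
  obtain ⟨z₂, hz₂, e₂⟩ := hIcc ⟨ht, le_rfl⟩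
  exact ⟨z₂, hsub hz₂, e₂⟩

theorem exp_arg_mul_I_eq {u : ℂ} (hne : u ≠ 0) :
    Complex.exp (-((-u.arg : ℝ) * Complex.I)) = ((‖u‖⁻¹ : ℝ) : ℂ) * u := by
  conv_rhs => rw [← Complex.norm_mul_exp_arg_mul_I u]
  rw [Complex.ofReal_neg, neg_mul, neg_neg, ← mul_assoc, ← Complex.ofReal_mul,
    norm_mul, Complex.norm_exp_ofReal_mul_I]
  simp [hne]

/-- At `0` the hypothesis reads `Re u > 0`, so `-arg u` is an admissible tilt, and positive scaling
replaces `u` by a unimodular number. -/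
theorem ClassZF.mem_ClassSplAll_of_re_pos {f : ℂ → ℂ} (hf : f ∈ ClassZF) {u : ℂ}
    (hu : ∀ z ∈ disk, 0 < (u * logDer f z).re) : f ∈ ClassSplAll := by
  have hu0 : 0 < u.re := by
    have := hu 0 zero_mem_disk
    rwa [logDer_zero hf.1, mul_one] at this
  have hne : u ≠ 0 := fun h => by simp [h] at hu0
  have harg := abs_lt.mp (Complex.abs_arg_lt_pi_div_two_iff.mpr (Or.inl hu0))
  refine ⟨-u.arg, by linarith [harg.2], by linarith [harg.1],
    ClassZF.mem_ClassSpl_of_re_pos hf fun z hz => ?_⟩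
  rw [exp_arg_mul_I_eq hne, mul_assoc, Complex.re_ofReal_mul]
  exact mul_pos (inv_pos.mpr (norm_pos_iff.mpr hne)) (hu z hz)

/-- The maps `y ↦ f y * exp (-t e^{il})` are subordinate to `f`; the infinitesimal Schwarz lemma
gives the weak inequality, and the value `cos l > 0` at the origin makes it strict by the minimum
principle. -/
theorem ClassSpl.re_pos {f : ℂ → ℂ} {l : ℝ} (hf : f ∈ ClassSpl l) (hl : 0 < Real.cos l)
    {z : ℂ} (hz : z ∈ disk) : 0 < (Complex.exp (-(l * Complex.I)) * logDer f z).re := by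
  have hZ := ClassS_subset_ClassZF hf.1
  have hre : (Complex.exp (-(l * Complex.I))).re = Real.cos l := by
    rw [← neg_mul, ← Complex.ofReal_neg, Complex.exp_ofReal_mul_I_re, Real.cos_neg]
  have hzero : 0 < (Complex.exp (-(l * Complex.I)) * logDer f 0).re := by
    rw [logDer_zero hf.1.1, mul_one, hre]; exact hl
  refine re_pos_of_re_nonneg (q := fun z => Complex.exp (-(l * Complex.I)) * logDer f z)
    (fun w hw => analyticAt_const.mul (analyticOnNhd_logDer hZ w hw)) (fun w hw => ?_) hzero hz
  by_cases hw0 : w = 0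
  · rw [hw0]; exact hzero.le
  set e : ℂ := Complex.exp (l * Complex.I) with he
  have hd : HasDerivAt (fun t : ℝ => f w * Complex.exp (-(t : ℂ) * e)) (f w * -e) 0 := by
    have h1 : HasDerivAt (fun s : ℝ => -(s : ℂ) * e) (-e) 0 := by
      simpa using (Complex.ofRealCLM.hasDerivAt (x := 0)).neg.mul_const e
    simpa using h1.cexp.const_mul (f w)
  have h1 := ClassS.re_le_zero_of_subordinate hf.1
    (Γ := fun t y => f y * Complex.exp (-(t : ℂ) * e)) hw
    (fun t _ y hy => (hf.1.1.1 y hy).mul analyticAt_const)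
    (fun t _ => by simp [hf.1.1.2.1]) (fun t ht y hy => ?_) (by simp) hd
  · rw [re_conj_mul_div hZ hw hw0, Complex.re_ofReal_mul, mul_neg, Complex.neg_re] at h1
    have h2 : 0 < ‖w‖ ^ 2 := by positivity
    have h3 : 0 ≤ ((logDer f w)⁻¹ * e).re := by nlinarith
    have h4 := re_inv_nonneg h3
    rw [mul_inv, inv_inv, exp_mul_I_inv, mul_comm] at h4
    exact h4
  · by_cases hy0 : y = 0
    · exact ⟨0, zero_mem_disk, by simp [hy0, hf.1.1.2.1]⟩
    · exact hf.2 (f y) (mem_image_of_mem f hy) (ClassZF.ne_zero hZ hy hy0)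
        (Or.inr ⟨t, ht.1, rfl⟩)

/-! ### Convex functions are starlike of order one half -/

theorem ClassConvex.re_nonneg_of_norm_eq {f : ℂ → ℂ} (hf : f ∈ ClassConvex) {z ζ : ℂ}
    (hz : z ∈ disk) (h : ‖ζ‖ = ‖z‖) :
    0 ≤ (z * deriv f z / (f z - f ζ)).re := by
  by_cases hz0 : z = 0
  · simp [hz0]
  set ω : ℂ := ζ / z with hω
  have hωn : ‖ω‖ = 1 := by rw [hω, norm_div, h, div_self (norm_ne_zero_iff.mpr hz0)]
  have hωz : ω * z = ζ := by rw [hω]; field_simp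
  have hωd : ∀ y ∈ disk, ω * y ∈ disk := fun y hy => by
    rw [mem_disk, norm_mul, hωn, one_mul]; exact mem_disk.mp hy
  -- By convexity of the image, the averages `(1 - t) f(y) + t f(ω y)` with the rotation `ω = ζ/z`
  -- are subordinate to `f`.
  have hd : HasDerivAt (fun t : ℝ => f z + (t : ℂ) * (f (ω * z) - f z)) (f ζ - f z) 0 := by
    have := ((Complex.ofRealCLM.hasDerivAt (x := 0)).mul_const
      (f (ω * z) - f z)).const_add (f z)
    simpa [hωz] using this
  have h1 := ClassS.re_le_zero_of_subordinate hf.1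
    (Γ := fun t y => f y + (t : ℂ) * (f (ω * y) - f y)) hz
    (fun t _ y hy => ?_) (fun t _ => by simp [hf.1.1.2.1]) (fun t ht y hy => ?_) (by simp) hd
  · have h2 : starRingEnd ℂ z * ((deriv f z)⁻¹ * (f ζ - f z)) =
        ((‖z‖ ^ 2 : ℝ) : ℂ) * -(z * deriv f z / (f z - f ζ))⁻¹ := by
      rw [Complex.ofReal_pow, ← Complex.conj_mul', inv_div, ← neg_div, neg_sub]
      have := ClassS.deriv_ne_zero hf.1 hz
      field_simp
    rw [h2, Complex.re_ofReal_mul, Complex.neg_re] at h1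
    have h3 : 0 < ‖z‖ ^ 2 := by positivity
    have h4 : 0 ≤ ((z * deriv f z / (f z - f ζ))⁻¹).re := by nlinarith
    simpa using re_inv_nonneg h4
  · have h2 : AnalyticAt ℂ (fun y => f (ω * y)) y :=
      (hf.1.1.1 _ (hωd y hy)).comp_of_eq (analyticAt_const.mul analyticAt_id) rfl
    exact (hf.1.1.1 y hy).add (analyticAt_const.mul (h2.sub (hf.1.1.1 y hy)))
  · have := hf.2.add_smul_sub_mem (mem_image_of_mem f hy) (mem_image_of_mem f (hωd y hy)) ht
    simpa using this

/-- Used to cancel the pole of `2 z f'(z) / (f z - f ζ)` at `ζ = z` without changing its real part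
on the circle `‖ζ‖ = ‖z‖`. -/
theorem re_add_div_sub_eq_zero {z ζ : ℂ} (h : ‖ζ‖ = ‖z‖) : ((z + ζ) / (z - ζ)).re = 0 := by
  have h2 : ζ.re * ζ.re + ζ.im * ζ.im = z.re * z.re + z.im * z.im := by
    rw [← Complex.normSq_apply, ← Complex.normSq_apply, Complex.normSq_eq_norm_sq,
      Complex.normSq_eq_norm_sq, h]
  rw [Complex.div_re, ← add_div]
  simp only [Complex.add_re, Complex.sub_re, Complex.add_im, Complex.sub_im]
  rw [div_eq_zero_iff]
  left
  linear_combination -h2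

/-- The Marx–Strohhäcker theorem: convex functions are starlike of order `1 / 2`. -/
theorem ClassConvex.half_lt_re_logDer {f : ℂ → ℂ} (hf : f ∈ ClassConvex) {z : ℂ}
    (hz : z ∈ disk) : 1 / 2 < (logDer f z).re := by
  have hZ := ClassS_subset_ClassZF hf.1
  suffices h : ∀ z ∈ disk, z ≠ 0 → 1 / 2 ≤ (logDer f z).re by
    have hq := re_pos_of_re_nonneg (q := fun z => logDer f z - 1 / 2)
      (fun w hw => (analyticOnNhd_logDer hZ w hw).sub analyticAt_const) (fun w hw => ?_)
      (by norm_num [logDer_zero hf.1.1]) hz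
    · norm_num at hq; linarith
    · by_cases hw0 : w = 0
      · norm_num [hw0, logDer_zero hf.1.1]
      · have := h w hw hw0
        norm_num; linarith
  intro z hz hz0
  have hfd := hf.1.1.1.differentiableOn
  set D : ℂ → ℂ := dslope f z with hD
  have hDd : DifferentiableOn ℂ D disk :=
    (Complex.differentiableOn_dslope (isOpen_disk.mem_nhds hz)).mpr hfd
  have hDz : D z = deriv f z := dslope_same f z
  have hDsub : ∀ ζ, (ζ - z) * D ζ = f ζ - f z := fun ζ => sub_smul_dslope f z ζ
  have hDne : ∀ ζ ∈ disk, D ζ ≠ 0 := by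
    intro ζ hζ h0
    by_cases h : ζ = z
    · rw [h, hDz] at h0; exact ClassS.deriv_ne_zero hf.1 hz h0
    · have := hDsub ζ
      rw [h0, mul_zero] at this
      exact h (hf.1.2 hζ hz (sub_eq_zero.mp this.symm))
  set N : ℂ → ℂ := fun ζ => 2 * z * D z - (z + ζ) * D ζ with hN
  have hNd : DifferentiableOn ℂ N disk :=
    (differentiableOn_const _).sub (((differentiableOn_const _).add differentiableOn_id).mul hDd)
  set E : ℂ → ℂ := dslope N z with hE
  have hEd : DifferentiableOn ℂ E disk :=
    (Complex.differentiableOn_dslope (isOpen_disk.mem_nhds hz)).mpr hNd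
  have hEsub : ∀ ζ, (ζ - z) * E ζ = N ζ := fun ζ => by
    have := sub_smul_dslope N z ζ
    have hNz : N z = 0 := by simp only [hN]; ring
    rwa [hNz, sub_zero] at this
  -- This is `2 z f'(z) / (f z - f ζ) - (z + ζ)/(z - ζ)` as a function of `ζ`; the pole at `z` is
  -- removable because `N z = 0`.
  set ψ : ℂ → ℂ := fun ζ => -E ζ / D ζ with hψ
  have hψd : DifferentiableOn ℂ ψ disk := hEd.neg.div hDd hDne
  have hψne : ∀ ζ ∈ disk, ζ ≠ z →
      ψ ζ = 2 * (z * deriv f z / (f z - f ζ)) - (z + ζ) / (z - ζ) := by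
    intro ζ hζ hne
    have h1 : f z - f ζ = (z - ζ) * D ζ := by linear_combination hDsub ζ
    have h2 : z - ζ ≠ 0 := sub_ne_zero.mpr (Ne.symm hne)
    have h3 := hDne ζ hζ
    have h4 : E ζ = -N ζ / (z - ζ) := by
      rw [← hEsub ζ]; field_simp; ring
    rw [h1, hψ]
    simp only [h4, hN, ← hDz]
    field_simp

  have hsub : Metric.closedBall (0 : ℂ) ‖z‖ ⊆ disk :=
    Metric.closedBall_subset_ball (mem_disk.mp hz)
  have hsphere : ∀ ζ, ‖ζ‖ = ‖z‖ → ζ ≠ z → 0 ≤ (ψ ζ).re := by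
    intro ζ h hne
    rw [hψne ζ (hsub (by simp [h])) hne, Complex.sub_re, re_add_div_sub_eq_zero h, sub_zero]
    have := ClassConvex.re_nonneg_of_norm_eq hf hz h
    simpa using this
  have hψz : 0 ≤ (ψ z).re := by
    have hpath : Tendsto (fun θ : ℝ => z * Complex.exp (θ * Complex.I)) (𝓝[>] 0) (𝓝 z) := by
      have : Continuous fun θ : ℝ => z * Complex.exp (θ * Complex.I) := by fun_prop
      have h2 := this.tendsto 0
      simp only [Complex.ofReal_zero, zero_mul, Complex.exp_zero, mul_one] at h2
      exact h2.mono_left nhdsWithin_le_nhds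
    have hcont : ContinuousAt ψ z := (hψd.differentiableAt (isOpen_disk.mem_nhds hz)).continuousAt
    have hlim := (Complex.continuous_re.tendsto _).comp (hcont.tendsto.comp hpath)
    refine ge_of_tendsto hlim ?_
    filter_upwards [Ioo_mem_nhdsGT Real.pi_pos] with θ hθ
    refine hsphere _ (by rw [norm_mul, Complex.norm_exp_ofReal_mul_I, mul_one]) fun h => ?_
    have h1 : Complex.exp (θ * Complex.I) = 1 := mul_left_cancel₀ hz0 (h.trans (mul_one z).symm)
    have h2 := congrArg Complex.im h1
    rw [Complex.exp_ofReal_mul_I_im, Complex.one_im] at h2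
    exact (Real.sin_pos_of_pos_of_lt_pi hθ.1 hθ.2).ne' h2
  -- The maximum principle for `exp (-ψ)` on the ball of radius `‖z‖` carries `Re ψ ≥ 0` from the
  -- circle to the centre, where `ψ 0 = 2 logDer f z - 1`.
  have hmax : ‖Complex.exp (-ψ 0)‖ ≤ 1 := by
    refine Complex.norm_le_of_forall_mem_frontier_norm_le (f := fun ζ => Complex.exp (-ψ ζ))
      (Metric.isBounded_ball (x := (0 : ℂ)) (r := ‖z‖)) ?_ ?_
      (subset_closure (Metric.mem_ball_self (norm_pos_iff.mpr hz0)))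
    · refine DifferentiableOn.diffContOnCl ?_
      exact (hψd.neg.cexp).mono
        ((closure_mono Metric.ball_subset_closedBall).trans
          (Metric.isClosed_closedBall.closure_subset.trans hsub))
    · intro ζ hζ
      rw [frontier_ball _ (norm_ne_zero_iff.mpr hz0), mem_sphere_zero_iff_norm] at hζ
      rw [Complex.norm_exp, Complex.neg_re]
      refine Real.exp_le_one_iff.mpr (neg_nonpos.mpr ?_)
      by_cases h : ζ = z
      · rw [h]; exact hψz
      · exact hsphere ζ hζ h
  rw [Complex.norm_exp, Complex.neg_re, Real.exp_le_one_iff, hψne 0 zero_mem_disk (Ne.symm hz0),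
    hf.1.1.2.1, sub_zero, ← logDer_of_ne hf.1.1.2.1 hz0] at hmax
  simp [hz0] at hmax
  linarith

/-! ### Sufficiency by convex separation -/

theorem ClassSplAll_subset_ClassS : ClassSplAll ⊆ ClassS := fun _ ⟨_, _, _, h⟩ => h.1

/-- If the variability region is convex and open, then the necessary condition for univalence of
the power deformations is also sufficient for spirallikeness. -/
theorem exponents_eq_complTV {M : Set (ℂ → ℂ)} (hM : M ⊆ ClassZF)
    (hconv : Convex ℝ (variability M)) (hopen : IsOpen (variability M)) :
    exponents M ClassS = complTV M ∧ exponents M ClassSplAll = complTV M := by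
  have h1 : complTV M ⊆ exponents M ClassSplAll := by
    intro c hc f hf
    obtain ⟨hK, hlog⟩ := powerDeformation_spec (hM hf) c
    rw [mem_complTV] at hc
    by_cases h0 : c = 0
    · refine ClassZF.mem_ClassSplAll_of_re_pos hK (u := 1) fun z hz => ?_
      rw [hlog z hz, h0]; simp
    -- A complex-linear `φ` is multiplication by `φ 1`, so the separating inequality `Re φ(p) < Re
    -- φ(1 - 1/c)` is `Re (u (1 - c + c p)) > 0` for `u = -φ 1 / c`.
    · obtain ⟨φ, hφ⟩ := RCLike.geometric_hahn_banach_open_point (𝕜 := ℂ) hconv hopen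
        (hc.resolve_left h0)
      refine ClassZF.mem_ClassSplAll_of_re_pos hK (u := -φ 1 / c) fun z hz => ?_
      have h2 := hφ _ ⟨f, hf, z, hz, rfl⟩
      have hlin : ∀ w, φ w = w * φ 1 := fun w => by
        rw [← smul_eq_mul, ← map_smul, smul_eq_mul, mul_one]
      rw [hlin, hlin (1 - 1 / c)] at h2
      simp only [RCLike.re_to_complex] at h2
      rw [hlog z hz]
      have h3 : -φ 1 / c * (1 - c + c * logDer f z) =
          (1 - 1 / c) * φ 1 - logDer f z * φ 1 := by
        field_simp
        ring
      rw [h3, Complex.sub_re]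
      linarith
  have h2 : exponents M ClassSplAll ⊆ exponents M ClassS :=
    fun c hc f hf => ClassSplAll_subset_ClassS (hc f hf)
  have h3 := exponents_ClassS_subset_complTV hM
  exact ⟨h3.antisymm (h1.trans h2), (h2.trans h3).antisymm h1⟩

/-! ### Half-planes, sectors and the variability regions -/

/-- The half-plane `Re (exp (-i l) w) > 0`. -/
def tiltedHalfPlane (l : ℝ) : Set ℂ := {w | 0 < (Complex.exp (-(l * Complex.I)) * w).re}

theorem re_exp_neg_mul (l : ℝ) (w : ℂ) :
    (Complex.exp (-(l * Complex.I)) * w).re = Real.cos l * w.re + Real.sin l * w.im := by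
  rw [← neg_mul, ← Complex.ofReal_neg, Complex.mul_re, Complex.exp_ofReal_mul_I_re,
    Complex.exp_ofReal_mul_I_im, Real.cos_neg, Real.sin_neg]
  ring

theorem mem_tiltedHalfPlane {l : ℝ} {w : ℂ} :
    w ∈ tiltedHalfPlane l ↔ 0 < Real.cos l * w.re + Real.sin l * w.im := by
  rw [tiltedHalfPlane, mem_ofPred_eq, re_exp_neg_mul]

theorem isOpen_tiltedHalfPlane (l : ℝ) : IsOpen (tiltedHalfPlane l) :=
  isOpen_lt continuous_const (by fun_prop)

theorem convex_tiltedHalfPlane (l : ℝ) : Convex ℝ (tiltedHalfPlane l) := by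
  intro x hx y hy a b ha hb hab
  rw [mem_tiltedHalfPlane] at *
  simp only [Complex.add_re, Complex.add_im, Complex.real_smul, Complex.re_ofReal_mul,
    Complex.im_ofReal_mul]
  have : Real.cos l * (a * x.re + b * y.re) + Real.sin l * (a * x.im + b * y.im) =
    a * (Real.cos l * x.re + Real.sin l * x.im) +
      b * (Real.cos l * y.re + Real.sin l * y.im) := by ring
  rw [this]
  rcases ha.eq_or_lt with h | h
  · have : b = 1 := by linarith
    rw [← h, this]; linarith
  · have := mul_pos h hx
    have := mul_nonneg hb hy.le
    linarith

/-- The bound `3π/2` is what `arg w - l` with `|arg w| ≤ π` and `|l| < π/2` requires. -/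
theorem cos_pos_iff_abs_lt {x : ℝ} (hx : |x| < 3 * Real.pi / 2) :
    0 < Real.cos x ↔ |x| < Real.pi / 2 := by
  rw [← Real.cos_abs]
  constructor
  · intro h
    by_contra! h2
    exact absurd h (not_lt.mpr
      (Real.cos_nonpos_of_pi_div_two_le_of_le h2 (by linarith)))
  · intro h
    exact Real.cos_pos_of_mem_Ioo ⟨by linarith [abs_nonneg x, Real.pi_pos], h⟩

theorem mem_tiltedHalfPlane_iff_arg {l : ℝ} (hl : |l| < Real.pi / 2) {w : ℂ} :
    w ∈ tiltedHalfPlane l ↔ w ≠ 0 ∧ |w.arg - l| < Real.pi / 2 := by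
  rw [mem_tiltedHalfPlane]
  have h1 : Real.cos l * w.re + Real.sin l * w.im = ‖w‖ * Real.cos (w.arg - l) := by
    rw [Real.cos_sub, ← Complex.norm_mul_cos_arg w, ← Complex.norm_mul_sin_arg w]; ring
  by_cases hw : w = 0
  · simp [hw]
  rw [h1, mul_pos_iff_of_pos_left (norm_pos_iff.mpr hw), cos_pos_iff_abs_lt, and_iff_right hw]
  have := Complex.abs_arg_le_pi w
  have := abs_sub w.arg l
  linarith

theorem tiltedHalfPlane_subset_slitPlane {l : ℝ} (hl : 0 < Real.cos l) :
    tiltedHalfPlane l ⊆ Complex.slitPlane := by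
  intro w hw
  rw [mem_tiltedHalfPlane] at hw
  rw [Complex.mem_slitPlane_iff]
  by_contra! h
  rw [h.2, mul_zero, add_zero] at hw
  nlinarith [h.1]

/-- The Möbius map of the disk onto `tiltedHalfPlane l` that sends `0` to `1`. -/
noncomputable def halfPlaneMap (l : ℝ) (z : ℂ) : ℂ :=
  (1 + Complex.exp (l * Complex.I) ^ 2 * z) / (1 - z)

theorem one_sub_ne_zero {z : ℂ} (hz : z ∈ disk) : 1 - z ≠ 0 := by
  rintro h
  rw [mem_disk, ← sub_eq_zero.mp h, norm_one] at hz
  exact lt_irrefl _ hz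

theorem halfPlaneMap_zero (l : ℝ) : halfPlaneMap l 0 = 1 := by simp [halfPlaneMap]

theorem analyticOnNhd_halfPlaneMap (l : ℝ) : AnalyticOnNhd ℂ (halfPlaneMap l) disk :=
  fun _ hz => (analyticAt_const.add (analyticAt_const.mul analyticAt_id)).div
    (analyticAt_const.sub analyticAt_id) (one_sub_ne_zero hz)

theorem exp_neg_mul_exp_sq (l : ℝ) :
    Complex.exp (-(l * Complex.I)) * Complex.exp (l * Complex.I) ^ 2 =
      Complex.exp (l * Complex.I) := by
  rw [pow_two, ← mul_assoc, ← Complex.exp_add]; simp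

theorem normSq_lt_one {z : ℂ} (hz : z ∈ disk) : z.re * z.re + z.im * z.im < 1 := by
  rw [← Complex.normSq_apply, Complex.normSq_eq_norm_sq]
  have := mem_disk.mp hz
  nlinarith [norm_nonneg z]

theorem halfPlaneMap_mem {l : ℝ} (hl : 0 < Real.cos l) {z : ℂ} (hz : z ∈ disk) :
    halfPlaneMap l z ∈ tiltedHalfPlane l := by
  have h1 : Complex.exp (-(l * Complex.I)) * halfPlaneMap l z =
      (Complex.exp ((-l : ℝ) * Complex.I) + Complex.exp (l * Complex.I) * z) / (1 - z) := by
    rw [halfPlaneMap, ← mul_div_assoc, mul_add, mul_one, ← mul_assoc, exp_neg_mul_exp_sq]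
    simp
  rw [tiltedHalfPlane, mem_ofPred_eq, h1, Complex.div_re, ← add_div]
  refine div_pos ?_ (Complex.normSq_pos.mpr (one_sub_ne_zero hz))
  simp only [Complex.add_re, Complex.add_im, Complex.mul_re, Complex.mul_im,
    Complex.exp_ofReal_mul_I_re, Complex.exp_ofReal_mul_I_im, Complex.sub_re, Complex.sub_im,
    Complex.one_re, Complex.one_im, Real.cos_neg, Real.sin_neg]
  -- The numerator of the real part is `cos l * (1 - ‖z‖ ^ 2)`.
  have h2 := mul_pos hl (sub_pos.mpr (normSq_lt_one hz))
  nlinarith [h2]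

theorem exists_halfPlaneMap_eq {l : ℝ} (hl : 0 < Real.cos l) {w : ℂ}
    (hw : w ∈ tiltedHalfPlane l) : ∃ z ∈ disk, halfPlaneMap l z = w := by
  -- The difference of the squares is `4 cos l * Re (e^{-il} w)`. The two norms are those of the
  -- numerator and denominator of the inverse Möbius map.
  have h0 : ‖w - 1‖ < ‖w + Complex.exp (l * Complex.I) ^ 2‖ := by
    apply lt_of_pow_lt_pow_left₀ 2 (norm_nonneg _)
    rw [← Complex.normSq_eq_norm_sq, ← Complex.normSq_eq_norm_sq, Complex.normSq_apply,
      Complex.normSq_apply]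
    rw [mem_tiltedHalfPlane] at hw
    simp only [pow_two, Complex.add_re, Complex.add_im, Complex.mul_re, Complex.mul_im,
      Complex.exp_ofReal_mul_I_re, Complex.exp_ofReal_mul_I_im, Complex.sub_re, Complex.sub_im,
      Complex.one_re, Complex.one_im]
    have hs : Real.sin l * Real.sin l = 1 - Real.cos l * Real.cos l := by
      linear_combination Real.sin_sq_add_cos_sq l
    have h2 := mul_pos hl hw
    have h3 : (Real.cos l * Real.cos l - Real.sin l * Real.sin l) ^ 2 +
        (Real.cos l * Real.sin l + Real.sin l * Real.cos l) ^ 2 = 1 := by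
      linear_combination (Real.sin l ^ 2 + Real.cos l ^ 2 + 1) * Real.sin_sq_add_cos_sq l
    have h4 : w.re * (Real.cos l * Real.cos l - Real.sin l * Real.sin l) =
      w.re * (2 * (Real.cos l * Real.cos l) - 1) := by rw [hs]; ring
    nlinarith [h2, h3, h4]
  have hne : w + Complex.exp (l * Complex.I) ^ 2 ≠ 0 :=
    norm_pos_iff.mp ((norm_nonneg _).trans_lt h0)
  have hne2 : 1 + Complex.exp (l * Complex.I) ^ 2 ≠ 0 := by
    intro h
    have h2 : w + Complex.exp (l * Complex.I) ^ 2 = w - 1 := by linear_combination h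
    rw [h2] at h0
    exact lt_irrefl _ h0
  refine ⟨(w - 1) / (w + Complex.exp (l * Complex.I) ^ 2), ?_, ?_⟩
  · rw [mem_disk, norm_div, div_lt_one ((norm_nonneg _).trans_lt h0)]
    exact h0
  · have h2 : 1 - (w - 1) / (w + Complex.exp (l * Complex.I) ^ 2) =
        (1 + Complex.exp (l * Complex.I) ^ 2) / (w + Complex.exp (l * Complex.I) ^ 2) := by
      field_simp
      ring
    rw [halfPlaneMap, h2]
    field_simp
    ring

/-- A single extremal function, whose `logDer` is `halfPlaneMap l`, attains every value. -/
theorem variability_ClassSpl {l : ℝ} (hl : 0 < Real.cos l) :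
    variability (ClassSpl l) = tiltedHalfPlane l := by
  ext w
  constructor
  · rintro ⟨f, hf, z, hz, rfl⟩
    exact ClassSpl.re_pos hf hl hz
  · intro hw
    obtain ⟨f, hf, hlog⟩ := exists_logDer_eq (analyticOnNhd_halfPlaneMap l) (halfPlaneMap_zero l)
    obtain ⟨z, hz, e⟩ := exists_halfPlaneMap_eq hl hw
    refine ⟨f, ClassZF.mem_ClassSpl_of_re_pos hf fun y hy => ?_, z, hz, ?_⟩
    · rw [hlog y hy]; exact halfPlaneMap_mem hl hy
    · rw [hlog z hz, e]

theorem mem_tiltedHalfPlane_zero {w : ℂ} : w ∈ tiltedHalfPlane 0 ↔ 0 < w.re := by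
  simp [mem_tiltedHalfPlane]

/-- The weak inequality defining the class becomes strict by the minimum principle, since `logDer`
is `1 > α` at the origin. The extremal `logDer` is an affine image of `halfPlaneMap 0`. -/
theorem variability_ClassStarlikeOrder {α : ℝ} (hα : α < 1) :
    variability (ClassStarlikeOrder α) = {w | α < w.re} := by
  have h1α : 0 < 1 - α := sub_pos.mpr hα
  ext w
  constructor
  · rintro ⟨f, hf, z, hz, rfl⟩
    have := re_pos_of_re_nonneg (q := fun z => logDer f z - α)
      (fun w hw => (analyticOnNhd_logDer hf.1 w hw).sub analyticAt_const)
      (fun w hw => by simpa using hf.2 w hw) (by simpa [logDer_zero hf.1.1] using hα) hz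
    simpa using this
  · intro hw
    have hw : α < w.re := hw
    have hcos : 0 < Real.cos 0 := by simp
    obtain ⟨f, hf, hlog⟩ := exists_logDer_eq
      (p := fun z => (α : ℂ) + ((1 - α : ℝ) : ℂ) * halfPlaneMap 0 z)
      (fun z hz => analyticAt_const.add
        (analyticAt_const.mul (analyticOnNhd_halfPlaneMap 0 z hz)))
      (by simp [halfPlaneMap_zero])
    obtain ⟨z, hz, e⟩ := exists_halfPlaneMap_eq (l := 0) hcos
      (w := ((1 - α)⁻¹ : ℝ) * (w - α)) (by
        rw [mem_tiltedHalfPlane_zero, Complex.re_ofReal_mul]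
        exact mul_pos (inv_pos.mpr h1α) (by simpa using hw))
    refine ⟨f, ⟨hf, fun y hy => ?_⟩, z, hz, ?_⟩
    · rw [hlog y hy, Complex.add_re, Complex.re_ofReal_mul, Complex.ofReal_re]
      have := mem_tiltedHalfPlane_zero.mp (halfPlaneMap_mem hcos hy)
      have := mul_pos h1α this
      linarith
    · rw [hlog z hz, e, ← mul_assoc, ← Complex.ofReal_mul, mul_inv_cancel₀ h1α.ne']
      simp

theorem hasDerivAt_div_one_sub {z : ℂ} (hz : z ∈ disk) :
    HasDerivAt (fun z : ℂ => z / (1 - z)) (1 / (1 - z) ^ 2) z := by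
  have h := (hasDerivAt_id z).div ((hasDerivAt_id z).const_sub 1) (one_sub_ne_zero hz)
  convert! h using 1
  simp

theorem half_lt_re_inv_one_sub {z : ℂ} (hz : z ∈ disk) : 1 / 2 < ((1 - z)⁻¹).re := by
  rw [Complex.inv_re, lt_div_iff₀ (Complex.normSq_pos.mpr (one_sub_ne_zero hz)),
    Complex.normSq_apply]
  simp only [Complex.sub_re, Complex.sub_im, Complex.one_re, Complex.one_im]
  nlinarith [normSq_lt_one hz]

theorem one_sub_inv_mem_disk {w : ℂ} (hw : 1 / 2 < w.re) : 1 - w⁻¹ ∈ disk := by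
  have hw0 : w ≠ 0 := fun h => by norm_num [h] at hw
  have h1 : 1 - w⁻¹ = (w - 1) / w := by field_simp
  rw [mem_disk, h1, norm_div, div_lt_one (norm_pos_iff.mpr hw0)]
  apply lt_of_pow_lt_pow_left₀ 2 (norm_nonneg _)
  rw [← Complex.normSq_eq_norm_sq, ← Complex.normSq_eq_norm_sq, Complex.normSq_apply,
    Complex.normSq_apply]
  simp only [Complex.sub_re, Complex.sub_im, Complex.one_re, Complex.one_im]
  nlinarith

theorem div_one_sub_eq {z : ℂ} (hz : z ∈ disk) : z / (1 - z) = (1 - z)⁻¹ - 1 := by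
  have := one_sub_ne_zero hz
  field_simp
  ring

theorem div_one_sub_mem_ClassConvex : (fun z : ℂ => z / (1 - z)) ∈ ClassConvex := by
  refine ⟨⟨⟨AnalyticOnNhd.of_hasDerivAt isOpen_disk fun z hz => hasDerivAt_div_one_sub hz,
    by simp, by simpa using (hasDerivAt_div_one_sub zero_mem_disk).deriv⟩, ?_⟩, ?_⟩
  · intro z hz w hw h
    simp only [div_one_sub_eq hz, div_one_sub_eq hw, sub_left_inj, inv_inj, sub_right_inj] at h
    exact h
  · have : (fun z : ℂ => z / (1 - z)) '' disk = {w | -(1 / 2) < w.re} := by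
      ext w
      constructor
      · rintro ⟨z, hz, rfl⟩
        have := half_lt_re_inv_one_sub hz
        simp only [div_one_sub_eq hz, mem_ofPred_eq, Complex.sub_re, Complex.one_re]
        linarith
      · intro hw
        have hw : -(1 / 2) < w.re := hw
        have hmem := one_sub_inv_mem_disk (w := w + 1) (by
          rw [Complex.add_re, Complex.one_re]; linarith)
        exact ⟨_, hmem, by simp only [div_one_sub_eq hmem]; simp⟩
    rw [this]
    exact convex_halfSpace_re_gt _

/-- Sharpness comes from `z/(1 - z)`, whose `z f'/f` is `1/(1 - z)` and fills the half-plane. -/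
theorem variability_ClassConvex : variability ClassConvex = {w | 1 / 2 < w.re} := by
  ext w
  constructor
  · rintro ⟨f, hf, z, hz, rfl⟩
    exact ClassConvex.half_lt_re_logDer hf hz
  · intro hw
    have hmem := one_sub_inv_mem_disk hw
    refine ⟨_, div_one_sub_mem_ClassConvex, _, hmem, ?_⟩
    by_cases h1 : w = 1
    · rw [h1, inv_one, sub_self, logDer_zero div_one_sub_mem_ClassConvex.1.1]
    · have hw0 : w ≠ 0 := fun h => by norm_num [h] at hw
      have hne : 1 - w⁻¹ ≠ 0 := by
        intro h
        exact h1 (inv_eq_one.mp (sub_eq_zero.mp h).symm)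
      rw [logDer_of_ne (by simp) hne, (hasDerivAt_div_one_sub hmem).deriv]
      simp only [sub_sub_cancel]
      field_simp

theorem abs_arg_sub_lt_of_mem_inter {l α : ℝ} {w : ℂ} (hα : 0 < α)
    (hl : |l| < Real.pi * α / 2) (hα1 : α < 1)
    (hw : w ∈ tiltedHalfPlane (l + Real.pi * (1 - α) / 2) ∩
      tiltedHalfPlane (l - Real.pi * (1 - α) / 2)) :
    w ≠ 0 ∧ |w.arg - l| < Real.pi * α / 2 := by
  obtain ⟨h1, h2⟩ := abs_lt.mp hl
  have h3 := mul_pos Real.pi_pos hα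
  have h4 := mul_pos Real.pi_pos (sub_pos.mpr hα1)
  rw [mem_inter_iff, mem_tiltedHalfPlane_iff_arg (abs_lt.mpr ⟨by linarith, by linarith⟩),
    mem_tiltedHalfPlane_iff_arg (abs_lt.mpr ⟨by linarith, by linarith⟩)] at hw
  obtain ⟨⟨h0, ha⟩, -, hb⟩ := hw
  rw [abs_lt] at ha hb
  exact ⟨h0, abs_lt.mpr ⟨by linarith, by linarith⟩⟩

theorem exp_mem_tiltedHalfPlane {l : ℝ} {L : ℂ} (h : |L.im - l| < Real.pi / 2) :
    Complex.exp L ∈ tiltedHalfPlane l := by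
  rw [mem_tiltedHalfPlane, Complex.exp_re, Complex.exp_im]
  have h1 := Real.cos_pos_of_mem_Ioo (abs_lt.mp h)
  rw [Real.cos_sub] at h1
  have h2 := mul_pos (Real.exp_pos L.re) h1
  linarith

theorem variability_ClassStronglySpl {l α : ℝ} (hl : |l| < Real.pi * α / 2) (hα1 : α < 1) :
    variability (ClassStronglySpl l α) = tiltedHalfPlane (l + Real.pi * (1 - α) / 2) ∩
      tiltedHalfPlane (l - Real.pi * (1 - α) / 2) := by
  have hα : 0 < α := by
    have := (abs_nonneg l).trans_lt hl
    by_contra! h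
    nlinarith [Real.pi_pos]
  have hlα : |l / α| < Real.pi / 2 := by
    rw [abs_div, abs_of_pos hα, div_lt_iff₀ hα]; linarith
  have hcos : 0 < Real.cos (l / α) := Real.cos_pos_of_mem_Ioo (abs_lt.mp hlα)
  have hπα := mul_pos Real.pi_pos (sub_pos.mpr hα1)
  ext w
  constructor
  · rintro ⟨f, hf, z, hz, rfl⟩
    have h1 := abs_lt.mp (hf.2.2 z hz)
    rw [← (log_spec hf.2.1).2.2 z hz]
    rw [Arg] at h1
    exact ⟨exp_mem_tiltedHalfPlane (abs_lt.mpr ⟨by linarith, by linarith⟩),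
      exp_mem_tiltedHalfPlane (abs_lt.mpr ⟨by linarith, by linarith⟩)⟩
  · intro hw
    obtain ⟨hw0, harg⟩ := abs_arg_sub_lt_of_mem_inter hα hl hα1 hw
    have hP := fun y (hy : y ∈ disk) => halfPlaneMap_mem hcos hy
    -- The extremal `logDer` is the `α`-th power of `halfPlaneMap (l / α)`: arguments within `π/2`
    -- of `l/α` become arguments within `πα/2` of `l`.
    set L : ℂ → ℂ := fun y => α * Complex.log (halfPlaneMap (l / α) y) with hL
    have hLan : AnalyticOnNhd ℂ L disk := fun y hy => analyticAt_const.mul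
      ((analyticOnNhd_halfPlaneMap _ y hy).clog (tiltedHalfPlane_subset_slitPlane hcos (hP y hy)))
    have hL0 : L 0 = 0 := by simp [hL, halfPlaneMap_zero]
    obtain ⟨f, hf, hlog⟩ := exists_logDer_eq (p := fun y => Complex.exp (L y))
      (fun y hy => (hLan y hy).cexp) (by simp [hL0])
    have hA : logDer f ∈ ClassA0x := ⟨analyticOnNhd_logDer hf, logDer_zero hf.1, fun y hy => by
      rw [hlog y hy]; exact Complex.exp_ne_zero _⟩
    have hargα : |w.arg / α - l / α| < Real.pi / 2 := by
      rw [← sub_div, abs_div, abs_of_pos hα, div_lt_iff₀ hα]; linarith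
    have him : (Complex.log w / α).im = w.arg / α := by
      rw [Complex.div_ofReal_im, Complex.log_im]
    obtain ⟨z, hz, e⟩ := exists_halfPlaneMap_eq hcos
      (exp_mem_tiltedHalfPlane (L := Complex.log w / α) (by rw [him]; exact hargα))
    refine ⟨f, ⟨hf, hA, fun y hy => ?_⟩, z, hz, ?_⟩
    · rw [Arg, Log_eqOn hA hLan hL0 (fun y hy => (hlog y hy).symm) hy, hL]
      have h1 := ((mem_tiltedHalfPlane_iff_arg hlα).mp (hP y hy)).2
      rw [Complex.im_ofReal_mul, Complex.log_im]
      have h2 : α * (halfPlaneMap (l / α) y).arg - l =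
          α * ((halfPlaneMap (l / α) y).arg - l / α) := by field_simp
      rw [h2, abs_mul, abs_of_pos hα]
      have := mul_lt_mul_of_pos_left h1 hα
      linarith
    · rw [abs_lt] at hargα hlα
      rw [hlog z hz, hL]
      simp only [e]
      rw [Complex.log_exp (by rw [him]; linarith) (by rw [him]; linarith)]
      have : (α : ℂ) ≠ 0 := by exact_mod_cast hα.ne'
      rw [mul_div_cancel₀ _ this, Complex.exp_log hw0]

/-! ### Close-to-convex functions and slit mappings -/

/-- Close-to-convex functions are univalent. -/
theorem ClassCloseToConvex_subset_ClassS : ClassCloseToConvex ⊆ ClassS := by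
  rintro f ⟨hf, g, hg, l, -, -, hpos⟩
  refine ⟨hf, fun z hz y hy h => ?_⟩
  obtain ⟨G, hG⟩ := ClassS.exists_inverse hg.1
  -- On the convex domain `g(𝔻)` the function `f ∘ g⁻¹` has derivative `f'/g'`, so the
  -- Noshiro–Warschawski criterion applies.
  have hinj : InjOn (fun w => f (G w)) (g '' disk) := by
    refine injOn_of_re_deriv_pos (F' := fun w => deriv f (G w) / deriv g (G w))
      (u := Complex.exp (-(l * Complex.I))) hg.2 ?_ ?_
    · rintro _ ⟨z, hz, rfl⟩
      have h1 := (hf.1 z hz).differentiableAt.hasDerivAt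
      have h2 := (hG z hz).2.hasDerivAt
      simp only [(hG z hz).1]
      have h3 : HasDerivAt f (deriv f z) (G (g z)) := by rw [(hG z hz).1]; exact h1
      exact h3.comp (g z) h2
    · rintro _ ⟨z, hz, rfl⟩
      simp only [(hG z hz).1]
      exact hpos z hz
  apply hg.1.2 hz hy
  refine hinj (mem_image_of_mem g hz) (mem_image_of_mem g hy) ?_
  simp only [(hG z hz).1, (hG y hy).1, h]

/-- The close-to-convex slit mappings `(z - m z ^ 2) / (1 - z) ^ 2` with `m = κ / (1 + κ)` and
purely imaginary `κ`. -/
noncomputable def slitMap (κ : ℂ) (z : ℂ) : ℂ :=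
  z * (1 - κ / (1 + κ) * z) / (1 - z) ^ 2

/-- In this form the quotient by the derivative of the convex map `z/(1 - z)` is visible: times `1 +
κ` it is `κ + (1 + z)/(1 - z)`, of positive real part when `κ` is imaginary. -/
theorem hasDerivAt_slitMap {κ : ℂ} (hκ : 1 + κ ≠ 0) {z : ℂ} (hz : z ∈ disk) :
    HasDerivAt (slitMap κ) ((κ + halfPlaneMap 0 z) / (1 + κ) / (1 - z) ^ 2) z := by
  have h1 := one_sub_ne_zero hz
  have h2 : HasDerivAt (fun z : ℂ => 1 - z) (-1) z := (hasDerivAt_id z).const_sub 1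
  have h3 : HasDerivAt (fun z : ℂ => 1 - κ / (1 + κ) * z) (-(κ / (1 + κ) * 1)) z :=
    ((hasDerivAt_id z).const_mul _).const_sub 1
  have h := ((hasDerivAt_id z).mul h3).div (h2.pow 2) (pow_ne_zero 2 h1)
  convert! h using 1
  simp only [halfPlaneMap, id, Pi.pow_apply, Pi.mul_apply]
  simp
  field_simp
  ring

theorem one_add_re_pos {κ : ℂ} (hκ : κ.re = 0) : 0 < (1 + κ).re := by simp [hκ]

theorem one_add_ne_zero_of_re {κ : ℂ} (hκ : κ.re = 0) : 1 + κ ≠ 0 := fun h => by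
  have := one_add_re_pos hκ
  simp [h] at this

theorem slitMap_mem_ClassCloseToConvex {κ : ℂ} (hκ : κ.re = 0) :
    slitMap κ ∈ ClassCloseToConvex := by
  have hre := one_add_re_pos hκ
  have hne := one_add_ne_zero_of_re hκ
  have harg := abs_lt.mp (Complex.abs_arg_lt_pi_div_two_iff.mpr (Or.inl hre))
  refine ⟨⟨AnalyticOnNhd.of_hasDerivAt isOpen_disk fun z hz => hasDerivAt_slitMap hne hz,
    by simp [slitMap], ?_⟩, _, div_one_sub_mem_ClassConvex, -(1 + κ).arg,
    by linarith [harg.2], by linarith [harg.1], fun z hz => ?_⟩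
  · rw [(hasDerivAt_slitMap hne zero_mem_disk).deriv, halfPlaneMap_zero, add_comm]
    simp [hne]
  · rw [(hasDerivAt_slitMap hne hz).deriv, (hasDerivAt_div_one_sub hz).deriv,
      exp_arg_mul_I_eq hne]
    have h1 := one_sub_ne_zero hz
    have h2 : ((‖1 + κ‖⁻¹ : ℝ) : ℂ) * (1 + κ) *
        ((κ + halfPlaneMap 0 z) / (1 + κ) / (1 - z) ^ 2 / (1 / (1 - z) ^ 2)) =
        ((‖1 + κ‖⁻¹ : ℝ) : ℂ) * (κ + halfPlaneMap 0 z) := by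
      field_simp
    rw [h2, Complex.re_ofReal_mul, Complex.add_re, hκ, zero_add]
    exact mul_pos (inv_pos.mpr (norm_pos_iff.mpr hne))
      (mem_tiltedHalfPlane_zero.mp (halfPlaneMap_mem (by simp) hz))

/-- Solvability of the equation for the value of the logarithmic derivative of a slit mapping. -/
theorem exists_re_pos_of_ne_zero {w : ℂ} (hw : w ≠ 0) :
    ∃ V κ : ℂ, 0 < V.re ∧ κ.re = 0 ∧ κ * (1 + V - 2 * w) = (1 + V) * (w - V) := by
  by_cases hpos : 0 < w.re
  · exact ⟨w, 0, hpos, by simp, by simp⟩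
  push Not at hpos
  obtain ⟨k, hk⟩ : ∃ k, k = -w.re := ⟨_, rfl⟩
  obtain ⟨β, hβ⟩ : ∃ β, β = w.im := ⟨_, rfl⟩
  have hk0 : 0 ≤ k := by linarith
  -- The expression is `N 0` below. For `k > 0` a large `b` with the sign of `β` works; for `k = 0`
  -- only the linear term is left, and `w ≠ 0` gives `β ≠ 0`.
  obtain ⟨b, hb⟩ : ∃ b : ℝ, 0 < k * b ^ 2 + 2 * β * b - k * (1 + 2 * k) - 2 * β ^ 2 := by
    rcases hk0.eq_or_lt with h | h
    · have hβ0 : β ≠ 0 := by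
        intro h2
        exact hw (Complex.ext (by rw [Complex.zero_re]; linarith)
          (by rw [← hβ, h2, Complex.zero_im]))
      refine ⟨2 * β, ?_⟩
      rw [← h]
      have : 0 < β ^ 2 := by positivity
      nlinarith
    · have hs : 0 ≤ (k * (1 + 2 * k) + 2 * β ^ 2) / k + 1 := by positivity
      have hsq := Real.sq_sqrt hs
      set s := Real.sqrt ((k * (1 + 2 * k) + 2 * β ^ 2) / k + 1) with hsdef
      have hs0 : 0 ≤ s := Real.sqrt_nonneg _
      have hks : k * s ^ 2 = k * (1 + 2 * k) + 2 * β ^ 2 + k := by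
        rw [hsq]; field_simp
      rcases le_total 0 β with h2 | h2
      · exact ⟨s, by nlinarith [mul_nonneg h2 hs0]⟩
      · refine ⟨-s, ?_⟩
        have : 0 ≤ -β * s := mul_nonneg (by linarith) hs0
        nlinarith
  -- With `V = a + ib`, the equation forces `κ = (1 + V)(w - V)/(1 + V - 2w)`; `N a` is the real
  -- part of the numerator times the conjugate denominator, so a zero `a > 0` of `N` makes `κ`
  -- imaginary. It exists because `N 0 > 0` while `N a` behaves like `-a³`.
  set N : ℝ → ℝ := fun a => (-(1 + a) * (k + a) - b * (β - b)) * (1 + a + 2 * k) +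
    ((1 + a) * (β - b) - b * (k + a)) * (b - 2 * β) with hN
  have hN0 : 0 < N 0 := by
    simp only [hN]
    nlinarith
  obtain ⟨a₁, ha₁, hNa⟩ : ∃ a₁ : ℝ, 0 ≤ a₁ ∧ N a₁ ≤ 0 := by
    set B := |b * (b - β)| with hB
    set c₁ := |(β - 2 * b) * (b - 2 * β)| with hc₁
    set c₀ := |(β - b - b * k) * (b - 2 * β)| with hc₀
    have hB0 : 0 ≤ B := abs_nonneg _
    have hc₁0 : 0 ≤ c₁ := abs_nonneg _
    have hc₀0 : 0 ≤ c₀ := abs_nonneg _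
    have hB1 : b * (b - β) ≤ B := le_abs_self _
    have hc₁1 : (β - 2 * b) * (b - 2 * β) ≤ c₁ := le_abs_self _
    have hc₀1 : (β - b - b * k) * (b - 2 * β) ≤ c₀ := le_abs_self _
    obtain ⟨a, ha⟩ : ∃ a, a = 1 + B + c₁ + c₀ := ⟨_, rfl⟩
    have ha1 : 1 ≤ a := by linarith
    have haa : a ≤ a ^ 2 := by nlinarith
    refine ⟨a, by linarith, ?_⟩
    have h1 : -(1 + a) * (k + a) - b * (β - b) ≤ B - a ^ 2 := by
      nlinarith [mul_nonneg (by linarith : (0 : ℝ) ≤ a) hk0]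
    have h2 : (-(1 + a) * (k + a) - b * (β - b)) * (1 + a + 2 * k) ≤ (B - a ^ 2) * a := by
      have h3 : B - a ^ 2 ≤ 0 := by linarith
      have h4 := mul_le_mul_of_nonneg_right h1 (by linarith : (0 : ℝ) ≤ 1 + a + 2 * k)
      have h5 := mul_le_mul_of_nonpos_left (by linarith : a ≤ 1 + a + 2 * k) h3
      linarith
    have h6 : ((1 + a) * (β - b) - b * (k + a)) * (b - 2 * β) ≤ (c₁ + c₀) * a := by
      have h7 := mul_le_mul_of_nonneg_right hc₁1 (by linarith : (0 : ℝ) ≤ a)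
      have h8 : c₀ ≤ c₀ * a := le_mul_of_one_le_right hc₀0 ha1
      nlinarith
    have h9 : (B - a ^ 2 + (c₁ + c₀)) * a ≤ 0 :=
      mul_nonpos_of_nonpos_of_nonneg (by linarith) (by linarith)
    simp only [hN]
    linarith
  have hcont : ContinuousOn N (Icc 0 a₁) := by
    have : Continuous N := by fun_prop
    exact this.continuousOn
  obtain ⟨a, ha, hNa0⟩ := intermediate_value_Icc' ha₁ hcont ⟨hNa, hN0.le⟩
  have ha0 : 0 < a := by
    rcases ha.1.eq_or_lt with h | h
    · rw [← h] at hNa0; exact absurd hNa0 hN0.ne'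
    · exact h
  set V : ℂ := ⟨a, b⟩ with hV
  have hQ : 1 + V - 2 * w ≠ 0 := by
    intro h
    have := congrArg Complex.re h
    simp [hV] at this
    linarith
  refine ⟨V, (1 + V) * (w - V) / (1 + V - 2 * w), ha0, ?_, div_mul_cancel₀ _ hQ⟩
  rw [Complex.div_re, ← add_div, div_eq_zero_iff]
  left
  simp only [hN] at hNa0
  rw [← hNa0]
  have hwre : w.re = -k := by linarith
  simp [hV, hwre, ← hβ]
  ring

/-- In the variable `V = (1 + z)/(1 - z)` the logarithmic derivative of the slit mapping is `(V +
1)(V + κ)/(V + 1 + 2κ)`, which leads to the equation just solved. -/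
theorem exists_logDer_slitMap_eq {w : ℂ} (hw : w ≠ 0) :
    ∃ κ : ℂ, κ.re = 0 ∧ ∃ z ∈ disk, w = logDer (slitMap κ) z := by
  obtain ⟨V, κ, hV, hκ, h⟩ := exists_re_pos_of_ne_zero hw
  have hV1 : V + 1 ≠ 0 := by
    intro h
    have := congrArg Complex.re h
    simp at this
    linarith
  have hVκ : V + 1 + 2 * κ ≠ 0 := by
    intro h
    have := congrArg Complex.re h
    simp [hκ] at this
    linarith
  have hκ1 := one_add_ne_zero_of_re hκ
  have hwV : w = (V + 1) * (V + κ) / (V + 1 + 2 * κ) := by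
    rw [eq_div_iff hVκ]
    linear_combination -h
  have hz : (V - 1) / (V + 1) ∈ disk := by
    rw [mem_disk, norm_div, div_lt_one (norm_pos_iff.mpr hV1)]
    apply lt_of_pow_lt_pow_left₀ 2 (norm_nonneg _)
    rw [← Complex.normSq_eq_norm_sq, ← Complex.normSq_eq_norm_sq, Complex.normSq_apply,
      Complex.normSq_apply]
    simp only [Complex.sub_re, Complex.sub_im, Complex.add_re, Complex.add_im, Complex.one_re,
      Complex.one_im]
    nlinarith
  refine ⟨κ, hκ, _, hz, ?_⟩
  by_cases h1 : V = 1
  · rw [h1, sub_self, zero_div, logDer_zero (slitMap_mem_ClassCloseToConvex hκ).1, hwV, h1]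
    rw [h1] at hVκ
    rw [div_eq_iff hVκ]
    ring
  · have hV1' : V - 1 ≠ 0 := sub_ne_zero.mpr h1
    have hz1 : 1 - (V - 1) / (V + 1) = 2 / (V + 1) := by field_simp; ring
    have hz2 : 1 - κ / (1 + κ) * ((V - 1) / (V + 1)) =
        (V + 1 + 2 * κ) / ((1 + κ) * (V + 1)) := by field_simp; ring
    have hz3 : halfPlaneMap 0 ((V - 1) / (V + 1)) = V := by
      rw [halfPlaneMap, hz1]
      simp
      field_simp
      ring
    rw [logDer_of_ne (by simp [slitMap]) (div_ne_zero hV1' hV1),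
      (hasDerivAt_slitMap hκ1 hz).deriv, slitMap, hz1, hz2, hz3, hwV]
    field_simp
    ring

theorem variability_ClassCloseToConvex : variability ClassCloseToConvex = {w | w ≠ 0} := by
  ext w
  constructor
  · rintro ⟨f, hf, z, hz, rfl⟩
    exact ClassS.logDer_ne_zero (ClassCloseToConvex_subset_ClassS hf) hz
  · intro hw
    obtain ⟨κ, hκ, z, hz, e⟩ := exists_logDer_slitMap_eq hw
    exact ⟨_, slitMap_mem_ClassCloseToConvex hκ, z, hz, e⟩

theorem variability_ClassS : variability ClassS = {w | w ≠ 0} := by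
  ext w
  constructor
  · rintro ⟨f, hf, z, hz, rfl⟩
    exact ClassS.logDer_ne_zero hf hz
  · intro hw
    obtain ⟨f, hf, h⟩ := variability_ClassCloseToConvex.ge hw
    exact ⟨f, ClassCloseToConvex_subset_ClassS hf, h⟩

theorem zero_one_subset_exponents_ClassS {M : Set (ℂ → ℂ)} (hM : M ⊆ ClassS) :
    {0, 1} ⊆ exponents M ClassS := by
  rintro c (rfl | rfl) f hf
  · have hZ := ClassS_subset_ClassZF (hM hf)
    refine ClassZF.mem_ClassS_of_re_pos (powerDeformation_spec hZ 0).1 (u := 1) fun z hz => ?_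
    rw [(powerDeformation_spec hZ 0).2 z hz]; simp
  · have hZ := ClassS_subset_ClassZF (hM hf)
    have heq : EqOn (powerDeformation 1 f) f disk := fun z hz => by
      rw [powerDeformation, one_mul]; exact (ClassZF.eq_mul_exp hZ hz).symm
    exact ⟨(powerDeformation_spec hZ 1).1.1, (hM hf).2.congr heq.symm⟩

/-- The punctured plane is not convex, so separation is unavailable; but its only omitted value `0`
is `1 - 1/c` for `c = 1`, and `K_0[f]` is the identity while `K_1[f] = f` on the disk. -/
theorem exponents_ClassS_of_variability {M : Set (ℂ → ℂ)} (hM : M ⊆ ClassS)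
    (hV : variability M = {w | w ≠ 0}) :
    exponents M ClassS = {0, 1} ∧ exponents M ClassS = complTV M := by
  have h1 : complTV M = {0, 1} := by
    ext c
    rw [mem_complTV, hV, mem_insert_iff, mem_singleton_iff]
    by_cases hc : c = 0
    · simp [hc]
    · simp only [hc, false_or, mem_ofPred_eq, not_not, sub_eq_zero]
      constructor
      · intro h
        field_simp at h
        exact h
      · rintro rfl; simp
  have h2 := exponents_ClassS_subset_complTV (hM.trans ClassS_subset_ClassZF)
  have h3 : exponents M ClassS = {0, 1} :=
    (h1 ▸ h2).antisymm (zero_one_subset_exponents_ClassS hM)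
  exact ⟨h3, h3.trans h1.symm⟩

/-! ### From half-planes to disks of exponents -/

theorem mem_closedBall_iff_normSq {c a : ℂ} {r : ℝ} (hr : 0 ≤ r) :
    c ∈ Metric.closedBall a r ↔
      (c.re - a.re) * (c.re - a.re) + (c.im - a.im) * (c.im - a.im) ≤ r ^ 2 := by
  rw [mem_closedBall_iff_norm, ← Complex.sub_re, ← Complex.sub_im, ← Complex.normSq_apply,
    Complex.normSq_eq_norm_sq, sq_le_sq₀ (norm_nonneg _) hr]

/-- The bounding circle passes through `0`, since `1 + tan² = 1/cos²` equates radius and modulus of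
the centre; hence no constant term. -/
theorem mem_closedBall_tan_iff {l : ℝ} (hl : 0 < Real.cos l) {c : ℂ} :
    c ∈ Metric.closedBall ((1 - Complex.I * (Real.tan l : ℂ)) / 2) (1 / (2 * Real.cos l)) ↔
      c.re * c.re + c.im * c.im ≤ c.re - Real.tan l * c.im := by
  have hr : (0 : ℝ) ≤ 1 / (2 * Real.cos l) := by positivity
  have h1 : ((1 - Complex.I * (Real.tan l : ℂ)) / 2).re = 1 / 2 := by
    rw [Complex.div_ofNat_re, Complex.sub_re, Complex.one_re, Complex.re_mul_ofReal,
      Complex.I_re]; simp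
  have h2 : ((1 - Complex.I * (Real.tan l : ℂ)) / 2).im = -Real.tan l / 2 := by
    rw [Complex.div_ofNat_im, Complex.sub_im, Complex.one_im, Complex.im_mul_ofReal,
      Complex.I_im]; simp
  rw [mem_closedBall_iff_normSq hr, h1, h2]
  have h3 : (1 / (2 * Real.cos l)) ^ 2 = (1 + Real.tan l ^ 2) / 4 := by
    have := Real.inv_one_add_tan_sq hl.ne'
    have h4 : 0 < 1 + Real.tan l ^ 2 := by positivity
    rw [div_pow, mul_pow, ← this]
    field_simp
    norm_num
  rw [h3]
  constructor <;> intro h <;> nlinarith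

theorem normSq_pos_of_ne {c : ℂ} (hc : c ≠ 0) : 0 < c.re * c.re + c.im * c.im := by
  rw [← Complex.normSq_apply]; exact Complex.normSq_pos.mpr hc

theorem one_sub_one_div_re (c : ℂ) :
    (1 - 1 / c).re = 1 - c.re / (c.re * c.re + c.im * c.im) := by
  rw [one_div, Complex.sub_re, Complex.inv_re, Complex.one_re, Complex.normSq_apply]

theorem one_sub_one_div_im (c : ℂ) :
    (1 - 1 / c).im = c.im / (c.re * c.re + c.im * c.im) := by
  rw [one_div, Complex.sub_im, Complex.inv_im, Complex.one_im, Complex.normSq_apply]; ring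

theorem eq_zero_or_notMem_tiltedHalfPlane_iff {l : ℝ} (hl : 0 < Real.cos l) {c : ℂ} :
    (c = 0 ∨ 1 - 1 / c ∉ tiltedHalfPlane l) ↔
      c ∈ Metric.closedBall ((1 - Complex.I * (Real.tan l : ℂ)) / 2) (1 / (2 * Real.cos l)) := by
  rw [mem_closedBall_tan_iff hl]
  by_cases hc : c = 0
  · simp [hc]
  have hpos := normSq_pos_of_ne hc
  rw [or_iff_right hc, mem_tiltedHalfPlane, not_lt, one_sub_one_div_re, one_sub_one_div_im]
  have h1 : Real.cos l * (1 - c.re / (c.re * c.re + c.im * c.im)) +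
      Real.sin l * (c.im / (c.re * c.re + c.im * c.im)) =
      Real.cos l * ((c.re * c.re + c.im * c.im) - (c.re - Real.tan l * c.im)) /
        (c.re * c.re + c.im * c.im) := by
    have hne : c.re ^ 2 + c.im ^ 2 ≠ 0 := by rw [pow_two, pow_two]; exact hpos.ne'
    rw [Real.tan_eq_sin_div_cos]
    field_simp
    ring
  rw [h1, div_le_iff₀ hpos, zero_mul, ← sub_nonpos (b := c.re - Real.tan l * c.im)]
  exact ⟨fun h => nonpos_of_mul_nonpos_right h hl, fun h => mul_nonpos_of_nonneg_of_nonpos hl.le h⟩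

theorem eq_zero_or_not_lt_re_iff {α : ℝ} (hα : α < 1) {c : ℂ} :
    (c = 0 ∨ 1 - 1 / c ∉ {w : ℂ | α < w.re}) ↔
      c ∈ Metric.closedBall (1 / (2 * (1 - (α : ℂ)))) (1 / (2 * (1 - α))) := by
  have h1α : 0 < 1 - α := sub_pos.mpr hα
  have hcast : 1 / (2 * (1 - (α : ℂ))) = ((1 / (2 * (1 - α)) : ℝ) : ℂ) := by push_cast; rfl
  rw [mem_closedBall_iff_normSq (by positivity), hcast, Complex.ofReal_re, Complex.ofReal_im]
  by_cases hc : c = 0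
  · simp [hc, pow_two]
  have hpos := normSq_pos_of_ne hc
  rw [or_iff_right hc, mem_ofPred_eq, not_lt, one_sub_one_div_re, sub_le_comm, le_div_iff₀ hpos]
  have h2 : (c.re - 1 / (2 * (1 - α))) * (c.re - 1 / (2 * (1 - α))) +
      (c.im - 0) * (c.im - 0) - (1 / (2 * (1 - α))) ^ 2 =
      ((1 - α) * (c.re * c.re + c.im * c.im) - c.re) / (1 - α) := by
    field_simp
    ring
  rw [← sub_nonpos (b := (1 / (2 * (1 - α))) ^ 2), h2, div_le_iff₀ h1α, zero_mul, sub_nonpos]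

/-- A combination of `exponents_eq_complTV` with the computation of the complement. -/
theorem exponents_eq_of_variability {M : Set (ℂ → ℂ)} {V B : Set ℂ} (hM : M ⊆ ClassZF)
    (hV : variability M = V) (hconv : Convex ℝ V) (hopen : IsOpen V)
    (hB : ∀ c : ℂ, (c = 0 ∨ 1 - 1 / c ∉ V) ↔ c ∈ B) :
    exponents M ClassS = B ∧ exponents M ClassSplAll = B ∧ exponents M ClassS = complTV M := by
  subst hV
  obtain ⟨h1, h2⟩ := exponents_eq_complTV hM hconv hopen
  have h3 : complTV M = B := by
    ext c
    rw [mem_complTV, hB]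
  exact ⟨h1.trans h3, h2.trans h3, h1⟩

theorem ClassSpl_subset_ClassZF (l : ℝ) : ClassSpl l ⊆ ClassZF :=
  fun _ hf => ClassS_subset_ClassZF hf.1

theorem exponents_ClassSpl {l : ℝ} (hl : 0 < Real.cos l) :
    exponents (ClassSpl l) ClassS =
        Metric.closedBall ((1 - Complex.I * (Real.tan l : ℂ)) / 2) (1 / (2 * Real.cos l)) ∧
      exponents (ClassSpl l) ClassSplAll =
        Metric.closedBall ((1 - Complex.I * (Real.tan l : ℂ)) / 2) (1 / (2 * Real.cos l)) ∧
      exponents (ClassSpl l) ClassS = complTV (ClassSpl l) :=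
  exponents_eq_of_variability (ClassSpl_subset_ClassZF l) (variability_ClassSpl hl)
    (convex_tiltedHalfPlane l) (isOpen_tiltedHalfPlane l)
    fun _ => eq_zero_or_notMem_tiltedHalfPlane_iff hl

theorem isOpen_lt_re (α : ℝ) : IsOpen {w : ℂ | α < w.re} :=
  isOpen_lt continuous_const Complex.continuous_re

theorem exponents_ClassStronglySpl {l α : ℝ} (hl : |l| < Real.pi * α / 2) (hα1 : α < 1)
    {lp lm : ℝ} (hlp : lp = l + Real.pi * (1 - α) / 2) (hlm : lm = l - Real.pi * (1 - α) / 2) :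
    exponents (ClassStronglySpl l α) ClassS =
        Metric.closedBall ((1 - Complex.I * (Real.tan lp : ℂ)) / 2) (1 / (2 * Real.cos lp)) ∪
          Metric.closedBall ((1 - Complex.I * (Real.tan lm : ℂ)) / 2) (1 / (2 * Real.cos lm)) ∧
      exponents (ClassStronglySpl l α) ClassSplAll =
        Metric.closedBall ((1 - Complex.I * (Real.tan lp : ℂ)) / 2) (1 / (2 * Real.cos lp)) ∪
          Metric.closedBall ((1 - Complex.I * (Real.tan lm : ℂ)) / 2) (1 / (2 * Real.cos lm)) ∧
      exponents (ClassStronglySpl l α) ClassS = complTV (ClassStronglySpl l α) := by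
  subst hlp hlm
  have hl' := abs_lt.mp hl
  have hπ := mul_pos Real.pi_pos (sub_pos.mpr hα1)
  have hcp : 0 < Real.cos (l + Real.pi * (1 - α) / 2) :=
    Real.cos_pos_of_mem_Ioo ⟨by linarith, by linarith⟩
  have hcm : 0 < Real.cos (l - Real.pi * (1 - α) / 2) :=
    Real.cos_pos_of_mem_Ioo ⟨by linarith, by linarith⟩
  refine exponents_eq_of_variability (fun f hf => hf.1) (variability_ClassStronglySpl hl hα1)
    ((convex_tiltedHalfPlane _).inter (convex_tiltedHalfPlane _))
    ((isOpen_tiltedHalfPlane _).inter (isOpen_tiltedHalfPlane _)) fun c => ?_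
  rw [mem_union, ← eq_zero_or_notMem_tiltedHalfPlane_iff hcp,
    ← eq_zero_or_notMem_tiltedHalfPlane_iff hcm, mem_inter_iff]
  tauto

theorem mem_exponents_ClassSplAll {N : Set (ℂ → ℂ)} {c : ℂ} :
    c ∈ exponents ClassSplAll N ↔
      ∀ l : ℝ, -(Real.pi / 2) < l → l < Real.pi / 2 → c ∈ exponents (ClassSpl l) N :=
  ⟨fun h l h1 h2 _ hf => h _ ⟨l, h1, h2, hf⟩, fun h _ ⟨l, h1, h2, hf⟩ => h l h1 h2 _ hf⟩

/-- The union of the half-planes over all tilts is the plane slit along `(-∞, 0]`, which is not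
convex. Instead, complements and exponent sets both turn the union of classes into an intersection.
-/
theorem mem_complTV_ClassSplAll {c : ℂ} :
    c ∈ complTV ClassSplAll ↔
      ∀ l : ℝ, -(Real.pi / 2) < l → l < Real.pi / 2 → c ∈ complTV (ClassSpl l) := by
  have hV : ∀ w, w ∈ variability ClassSplAll ↔
      ∃ l : ℝ, -(Real.pi / 2) < l ∧ l < Real.pi / 2 ∧ w ∈ variability (ClassSpl l) := fun w =>
    ⟨fun ⟨f, ⟨l, h1, h2, hf⟩, h⟩ => ⟨l, h1, h2, f, hf, h⟩,
      fun ⟨l, h1, h2, f, hf, h⟩ => ⟨f, ⟨l, h1, h2, hf⟩, h⟩⟩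
  simp only [mem_complTV, hV]
  push Not
  by_cases hc : c = 0 <;> simp [hc]

theorem forall_mem_closedBall_tan_iff {c : ℂ} :
    (∀ l : ℝ, -(Real.pi / 2) < l → l < Real.pi / 2 → c ∈
      Metric.closedBall ((1 - Complex.I * (Real.tan l : ℂ)) / 2) (1 / (2 * Real.cos l))) ↔
      c ∈ (fun t : ℝ => (t : ℂ)) '' Icc 0 1 := by
  constructor
  · intro h
    have h' : ∀ t : ℝ, c.re * c.re + c.im * c.im ≤ c.re - t * c.im := by
      intro t
      have h1 := h (Real.arctan t) (Real.neg_pi_div_two_lt_arctan t) (Real.arctan_lt_pi_div_two t)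
      rwa [mem_closedBall_tan_iff (Real.cos_arctan_pos t), Real.tan_arctan] at h1
    have him : c.im = 0 := by
      by_contra hne
      -- Every real `t` is a tangent; this one makes the right-hand side `-1`, below a sum of
      -- squares.
      have h1 := h' ((1 + c.re) / c.im)
      rw [div_mul_cancel₀ _ hne] at h1
      nlinarith [mul_self_nonneg c.re, mul_self_nonneg c.im]
    have h0 := h' 0
    rw [him] at h0
    exact ⟨c.re, ⟨by nlinarith [mul_self_nonneg c.re], by nlinarith⟩,
      Complex.ext (by simp) (by simp [him])⟩
  · rintro ⟨t, ht, rfl⟩ l h1 h2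
    rw [mem_closedBall_tan_iff (Real.cos_pos_of_mem_Ioo ⟨h1, h2⟩)]
    simp only [Complex.ofReal_re, Complex.ofReal_im]
    nlinarith [ht.1, ht.2]

theorem ClassStronglyStarlike_eq (α : ℝ) : ClassStronglyStarlike α = ClassStronglySpl 0 α := by
  simp [ClassStronglyStarlike, ClassStronglySpl]

theorem tan_pi_div_two_sub_eq_cot (x : ℝ) : Real.tan (Real.pi / 2 - x) = Real.cot x := by
  rw [Real.tan_pi_div_two_sub, Real.tan_eq_sin_div_cos, Real.cot_eq_cos_div_sin, inv_div]

end PowerDeformation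

theorem theorem1 :
    (exponents ClassStarlike ClassS = Metric.closedBall (1 / 2 : ℂ) (1 / 2) ∧
      exponents ClassStarlike ClassSplAll = Metric.closedBall (1 / 2 : ℂ) (1 / 2) ∧
      exponents ClassStarlike ClassS = complTV ClassStarlike) ∧
    (∀ α : ℝ, 0 ≤ α → α < 1 →
      exponents (ClassStarlikeOrder α) ClassS =
        Metric.closedBall (1 / (2 * (1 - (α : ℂ)))) (1 / (2 * (1 - α))) ∧
      exponents (ClassStarlikeOrder α) ClassSplAll =
        Metric.closedBall (1 / (2 * (1 - (α : ℂ)))) (1 / (2 * (1 - α))) ∧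
      exponents (ClassStarlikeOrder α) ClassS = complTV (ClassStarlikeOrder α)) ∧
    (exponents ClassConvex ClassS = Metric.closedBall (1 : ℂ) 1 ∧
      exponents ClassConvex ClassSplAll = Metric.closedBall (1 : ℂ) 1 ∧
      exponents ClassConvex ClassS = complTV ClassConvex) ∧
    (∀ l : ℝ, -(Real.pi / 2) < l → l < Real.pi / 2 →
      exponents (ClassSpl l) ClassS =
        Metric.closedBall ((1 - Complex.I * (Real.tan l : ℂ)) / 2) (1 / (2 * Real.cos l)) ∧
      exponents (ClassSpl l) ClassSplAll =
        Metric.closedBall ((1 - Complex.I * (Real.tan l : ℂ)) / 2) (1 / (2 * Real.cos l)) ∧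
      exponents (ClassSpl l) ClassS = complTV (ClassSpl l)) ∧
    (exponents ClassSplAll ClassS = (fun t : ℝ => (t : ℂ)) '' Set.Icc 0 1 ∧
      exponents ClassSplAll ClassSplAll = (fun t : ℝ => (t : ℂ)) '' Set.Icc 0 1 ∧
      exponents ClassSplAll ClassS = complTV ClassSplAll) ∧
    (∀ α : ℝ, 0 < α → α < 1 →
      exponents (ClassStronglyStarlike α) ClassS =
        Metric.closedBall ((1 - Complex.I * (Real.cot (Real.pi * α / 2) : ℂ)) / 2)
            (1 / (2 * Real.sin (Real.pi * α / 2))) ∪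
          Metric.closedBall ((1 + Complex.I * (Real.cot (Real.pi * α / 2) : ℂ)) / 2)
            (1 / (2 * Real.sin (Real.pi * α / 2))) ∧
      exponents (ClassStronglyStarlike α) ClassSplAll =
        Metric.closedBall ((1 - Complex.I * (Real.cot (Real.pi * α / 2) : ℂ)) / 2)
            (1 / (2 * Real.sin (Real.pi * α / 2))) ∪
          Metric.closedBall ((1 + Complex.I * (Real.cot (Real.pi * α / 2) : ℂ)) / 2)
            (1 / (2 * Real.sin (Real.pi * α / 2))) ∧
      exponents (ClassStronglyStarlike α) ClassS = complTV (ClassStronglyStarlike α)) ∧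
    (∀ l α lp lm : ℝ, |l| < Real.pi * α / 2 → Real.pi * α / 2 < Real.pi / 2 →
      lp = l + Real.pi * (1 - α) / 2 → lm = l - Real.pi * (1 - α) / 2 →
      exponents (ClassStronglySpl l α) ClassS =
        Metric.closedBall ((1 - Complex.I * (Real.tan lp : ℂ)) / 2) (1 / (2 * Real.cos lp)) ∪
          Metric.closedBall ((1 - Complex.I * (Real.tan lm : ℂ)) / 2) (1 / (2 * Real.cos lm)) ∧
      exponents (ClassStronglySpl l α) ClassSplAll =
        Metric.closedBall ((1 - Complex.I * (Real.tan lp : ℂ)) / 2) (1 / (2 * Real.cos lp)) ∪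
          Metric.closedBall ((1 - Complex.I * (Real.tan lm : ℂ)) / 2) (1 / (2 * Real.cos lm)) ∧
      exponents (ClassStronglySpl l α) ClassS = complTV (ClassStronglySpl l α)) ∧
    (exponents ClassS ClassS = {0, 1} ∧
      exponents ClassCloseToConvex ClassS = {0, 1} ∧
      exponents ClassS ClassS = complTV ClassS ∧
      exponents ClassCloseToConvex ClassS = complTV ClassCloseToConvex) := by

  refine ⟨?_, ?_, ?_, ?_, ?_, ?_, ?_, ?_⟩
  · have h := exponents_ClassSpl (l := 0) (by simp)
    simpa [ClassStarlike] using h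
  · intro α _ hα
    refine exponents_eq_of_variability (fun f hf => hf.1) (variability_ClassStarlikeOrder hα)
      (convex_halfSpace_re_gt α) (isOpen_lt_re α) fun _ => eq_zero_or_not_lt_re_iff hα
  · refine exponents_eq_of_variability (fun f hf => ClassS_subset_ClassZF hf.1)
      variability_ClassConvex (convex_halfSpace_re_gt _) (isOpen_lt_re _) fun c => ?_
    rw [eq_zero_or_not_lt_re_iff (by norm_num)]
    norm_num
  · intro l h1 h2
    exact exponents_ClassSpl (Real.cos_pos_of_mem_Ioo ⟨h1, h2⟩)
  · have hspl := fun (l : ℝ) (h1 : -(Real.pi / 2) < l) (h2 : l < Real.pi / 2) =>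
      exponents_ClassSpl (Real.cos_pos_of_mem_Ioo ⟨h1, h2⟩)
    refine ⟨?_, ?_, ?_⟩ <;> ext c
    · rw [mem_exponents_ClassSplAll, ← forall_mem_closedBall_tan_iff]
      exact forall_congr' fun l => forall₂_congr fun h1 h2 => by rw [(hspl l h1 h2).1]
    · rw [mem_exponents_ClassSplAll, ← forall_mem_closedBall_tan_iff]
      exact forall_congr' fun l => forall₂_congr fun h1 h2 => by rw [(hspl l h1 h2).2.1]
    · rw [mem_exponents_ClassSplAll, mem_complTV_ClassSplAll]
      exact forall_congr' fun l => forall₂_congr fun h1 h2 => by rw [(hspl l h1 h2).2.2]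
  · intro α h0 h1
    -- For `l = 0` the two tilts are opposite, complementary to `πα/2`: tangent becomes cotangent
    -- and cosine becomes sine.
    have hp : Real.pi / 2 - Real.pi * α / 2 = 0 + Real.pi * (1 - α) / 2 := by ring
    have hm : -(Real.pi / 2 - Real.pi * α / 2) = 0 - Real.pi * (1 - α) / 2 := by ring
    have h := exponents_ClassStronglySpl (l := 0) (α := α) (by rw [abs_zero]; positivity) h1 hp hm
    rw [← ClassStronglyStarlike_eq, Real.tan_neg, Real.cos_neg, tan_pi_div_two_sub_eq_cot,
      Real.cos_pi_div_two_sub, Complex.ofReal_neg, mul_neg, sub_neg_eq_add] at h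
    exact h
  · intro l α lp lm h1 h2 h3 h4
    refine exponents_ClassStronglySpl h1 ?_ h3 h4
    nlinarith [Real.pi_pos]
  · obtain ⟨h1, h2⟩ := exponents_ClassS_of_variability subset_rfl variability_ClassS
    obtain ⟨h3, h4⟩ := exponents_ClassS_of_variability ClassCloseToConvex_subset_ClassS
      variability_ClassCloseToConvex
    exact ⟨h1, h3, h2, h4⟩
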